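/- **Definitions.** A correction function is a non-decreasing $\alpha:\mathbb N\to\mathbb N$ with $\alpha(n)\ge n$; extend it by $\alpha(\infty)=\infty$. For $f,g:E\to\mathbb N\cup\{\infty\}$ write $f\preccurlyeq g$ ($f$ is dominated by $g$) if $f\le\alpha\circ g$ for some correction function $\alpha$, and $f\approx g$ if $f\preccurlyeq g$ and $g\preccurlyeq f$. A cost function over $E$ is a class of $\approx$. A stabilisation monoid is a finite monoid $M$ with a partial order compatible with the product and a map $\sharp$ from idempotents to idempotents such that, for idempotents, $e\le f$ implies $e^\sharp\le f^\sharp$, $e^\sharp\le e$, $(e^\sharp)^\sharp=e^\sharp$, $1^\sharp=1$, and $(ab)^\sharp=a(ba)^\sharp b$ whenever $ab$ and $ba$ are idempotent. An ideal is a downward closed subset of $M$. An $n$-computation for $u\in M^+$ is a finite ordered tree whose nodes carry values in $M$, whose leaves, from left to right, have the letters of $u$ as values, and each inner node of which has either (binary) two children and as value the product of their values; or (idempotent) $k$ children with $2\le k\le n$, all with the same idempotent value $e$, and value $e$; or (stabilisation) $k>n$ children, all with the same idempotent value $e$, and value $e^\sharp$. In $n$-under-computations (resp. $n$-over-computations)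 the value of each node (leaves included) is only required to be $\le$ (resp. $\ge$) the prescribed one. The value of a tree is that of its root; its height does not count leaves. An [under- /over-]computation for $u\in M^*$ is one for some word of $M^+$ from which $u$ arises by deleting some letters $1$. For an alphabet $A$, $h:A\to M$ (extended letterwise to words), an ideal $I$ and $p\in\mathbb N$, let $[\![M,h,I]\!]^{-}_p(u)$ (resp. $[\![M,h,I]\!]^{--}_p(u)$) be the infimum of the $n$ for which $h(u)$ has an $n$-computation (resp. $n$-under-computation) of height at most $p$ and value in $M\setminus I$, and let $[\![M,h,I]\!]^{+}_p(u)$ (resp. $[\![M,h,I]\!]^{++}_p(u)$) be the supremum of the $n+1$ for which $h(u)$ has an $n$-computation (resp. $n$-over-computation) of height at most $p$ and value in $I$. The cost function recognised by $(M,h,I)$ is the $\approx$-class of $[\![M,h,I]\!]^{+}_{3|M|}$. A $\sharp$-expression over $A$ is built from letters of $A$ by products and exponents $\omega\sharp$. Its value under $h$ is obtained by reading letters through $h$ and $a^{\omega\sharp}$ as $(a^\omega)^\sharp$, $a^\omega=a^{|M|!}$ being the idempotent power of $a$. Its $n$-unfolding $\mathrm{unf}(E,n)\in A^+$ is the word obtained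 by reading $\omega\sharp$ as the $n$-th power. For $X\subseteq M$, $\langle X\rangle^\sharp$ is the set of values of $\sharp$-expressions over $X$. **Theorem.** 1. The domination relation $\preccurlyeq$ is decidable over recognisable cost functions: there is an algorithm that, given recognisers $(M,h,I)$ and $(M',h',J)$ over the same finite alphabet (by finite tables), decides whether $f\preccurlyeq g$ for the cost functions $f$, $g$ that they recognise. 2. The recognised cost function is well defined: for every $p\ge 3|M|$ the four functions $[\![M,h,I]\!]^{--}_p$, $[\![M,h,I]\!]^{-}_p$, $[\![M,h,I]\!]^{+}_p$, $[\![M,h,I]\!]^{++}_p$ belong to the cost function recognised by $(M,h,I)$. 3. Let $f$ and $g$ belong to the cost functions recognised by $(M,h,I)$ and $(M,h,J)$. Then - $f\preccurlyeq g$ if and only if $(\langle h(A)\rangle^\sharp\cup\{1\})\cap I\subseteq J$; - the restrictions to non-empty words satisfy $f|_{A^+}\preccurlyeq g|_{A^+}$ if and only if $\langle h(A)\rangle^\sharp\cap I\subseteq J$; - if $E$ is a $\sharp$-expression over $A$ whose value is in $I\setminus J$, then for every positive multiple $\Omega$ of $|M|!$, $f(\mathrm{unf}(E,\Omega n))$ tends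 to infinity with $n$ while $g$ is bounded on $\{\mathrm{unf}(E,\Omega n):n\ge1\}$; - $f\not\preccurlyeq g$ if and only if there is a $\sharp$-expression over $A$ with value in $I\setminus J$, or $f(\varepsilon)=\infty$ and $g(\varepsilon)<\infty$. -/

import Mathlib

/-! ### Domination and cost functions -/

/-- A correction function: a non-decreasing map `α : ℕ → ℕ` with `n ≤ α n` for all `n`. -/
def IsCorrection (α : ℕ → ℕ) : Prop :=
  Monotone α ∧ ∀ n, n ≤ α n

/-- `f ≼_α g`: pointwise `f ≤ ᾱ ∘ g`, where `ᾱ` extends `α` by `ᾱ ∞ = ∞`. -/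
def DominatedBy {E : Type*} (α : ℕ → ℕ) (f g : E → ℕ∞) : Prop :=
  ∀ x, f x ≤ ENat.map α (g x)

/-- The domination preorder `f ≼ g`. -/
def Dominated {E : Type*} (f g : E → ℕ∞) : Prop :=
  ∃ α, IsCorrection α ∧ DominatedBy α f g

/-- The equivalence `f ≈ g`; its classes are the cost functions over `E`. -/
def CostEquiv {E : Type*} (f g : E → ℕ∞) : Prop :=
  ∃ α, IsCorrection α ∧ DominatedBy α f g ∧ DominatedBy α g f

/-! ### Stabilisation monoids -/

/-- A stabilisation monoid: a finite ordered monoid with a stabilisation `♯` on its idempotents.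
`sharp` is a total function here, but every law, and every later use of `sharp`, concerns
idempotents only; its values elsewhere are irrelevant. -/
class StabilisationMonoid (M : Type*) extends Monoid M, PartialOrder M where
  finite : Finite M
  mul_le_mul : ∀ a a' b b' : M, a ≤ a' → b ≤ b' → a * b ≤ a' * b'
  sharp : M → M
  sharp_idempotent : ∀ e : M, IsIdempotentElem e → IsIdempotentElem (sharp e)
  sharp_mono : ∀ e f : M, IsIdempotentElem e → IsIdempotentElem f → e ≤ f → sharp e ≤ sharp f
  sharp_consistent : ∀ a b : M, IsIdempotentElem (a * b) → IsIdempotentElem (b * a) →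
    sharp (a * b) = a * sharp (b * a) * b
  sharp_le : ∀ e : M, IsIdempotentElem e → sharp e ≤ e
  sharp_sharp : ∀ e : M, IsIdempotentElem e → sharp (sharp e) = sharp e
  sharp_one : sharp 1 = 1

namespace StabilisationMonoid

/-! ### Computations -/

/-- Ordered unranked finite trees whose nodes are labelled by elements of `M`. -/
inductive CompTree (M : Type*) where
  | leaf (v : M) : CompTree M
  | node (v : M) (k : ℕ) (children : Fin k → CompTree M) : CompTree M

/-- The label of the root. -/
def CompTree.value {M : Type*} : CompTree M → M
  | .leaf v => v
  | .node v _ _ => v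

/-- The height; leaves do not count. -/
def CompTree.height {M : Type*} : CompTree M → ℕ
  | .leaf _ => 0
  | .node _ _ c => (Finset.univ.sup fun i => (c i).height) + 1

/-- `IsComp R n T u`: the tree `T` is a computation with threshold `n` for the word `u`, where each
node value `v` is compared by `R v x` with the value `x` prescribed by its letter or children.
`R = (· ≤ ·)` gives `n`-under-computations, `R = (· ≥ ·)` gives `n`-over-computations and
`R = (· = ·)` gives `n`-computations. The word of an inner node is the concatenation of the words
of its children from left to right. The three alternatives at an inner node of degree `k` are
binary nodes, idempotent nodes and stabilisation nodes (so an inner node has degree `k ≥ 1`). -/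
def IsComp {M : Type*} [StabilisationMonoid M] (R : M → M → Prop) (n : ℕ) :
    CompTree M → List M → Prop
  | .leaf v, u => ∃ a, u = [a] ∧ R v a
  | .node v k c, u =>
      (∃ us : Fin k → List M, u = (List.ofFn us).flatten ∧ ∀ i, IsComp R n (c i) (us i)) ∧
      ((k = 2 ∧ R v (List.ofFn fun i => (c i).value).prod) ∨
        (2 ≤ k ∧ k ≤ n ∧ ∃ e, IsIdempotentElem e ∧ (∀ i, (c i).value = e) ∧ R v e) ∨
        (n < k ∧ ∃ e, IsIdempotentElem e ∧ (∀ i, (c i).value = e) ∧ R v (sharp e)))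

/-- `DeletesOnes v u`: the word `u` is obtained from `v` by deleting some occurrences of the
letter `1`. -/
inductive DeletesOnes {M : Type*} [One M] : List M → List M → Prop
  | nil : DeletesOnes [] []
  | keep (a : M) {v u : List M} : DeletesOnes v u → DeletesOnes (a :: v) (a :: u)
  | delete {v u : List M} : DeletesOnes v u → DeletesOnes (1 :: v) u

/-- There is a (stabilisation monoid) computation with threshold `n` for `u ∈ M*`, of height at most
`p` and value in `X`. Copies of the unit may be interleaved with `u`, which is what gives
computations for the empty word. -/
def HasComp {M : Type*} [StabilisationMonoid M] (R : M → M → Prop) (n p : ℕ) (u : List M)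
    (X : Set M) : Prop :=
  ∃ (v : List M) (T : CompTree M),
    DeletesOnes v u ∧ IsComp R n T v ∧ T.height ≤ p ∧ T.value ∈ X

/-! ### Recognised cost functions -/

section Recognition

variable {A M : Type*} [StabilisationMonoid M]

/-- `inf {n : there is an n-under-computation of value in M \ I of height ≤ p for h(u)}`. -/
noncomputable def semMinusMinus (h : A → M) (I : Set M) (p : ℕ) (u : List A) : ℕ∞ :=
  sInf {x : ℕ∞ | ∃ n : ℕ, x = n ∧ HasComp (· ≤ ·) n p (u.map h) Iᶜ}

/-- `inf {n : there is an n-computation of value in M \ I of height ≤ p for h(u)}`. -/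
noncomputable def semMinus (h : A → M) (I : Set M) (p : ℕ) (u : List A) : ℕ∞ :=
  sInf {x : ℕ∞ | ∃ n : ℕ, x = n ∧ HasComp (· = ·) n p (u.map h) Iᶜ}

/-- `sup {n + 1 : there is an n-computation of value in I of height ≤ p for h(u)}`. -/
noncomputable def semPlus (h : A → M) (I : Set M) (p : ℕ) (u : List A) : ℕ∞ :=
  sSup {x : ℕ∞ | ∃ n : ℕ, x = n + 1 ∧ HasComp (· = ·) n p (u.map h) I}

/-- `sup {n + 1 : there is an n-over-computation of value in I of height ≤ p for h(u)}`. -/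
noncomputable def semPlusPlus (h : A → M) (I : Set M) (p : ℕ) (u : List A) : ℕ∞ :=
  sSup {x : ℕ∞ | ∃ n : ℕ, x = n + 1 ∧ HasComp (· ≥ ·) n p (u.map h) I}

/-- The cost function recognised by `M, h, I`, as the set of its members: the `≈`-class of
`semPlus h I (3 |M|)`. That it is also the class of each of the four functions above, for every
height bound `p ≥ 3 |M|`, is a part of the main statement. -/
def costFunction (h : A → M) (I : Set M) : Set (List A → ℕ∞) :=
  {f | CostEquiv f (semPlus h I (3 * Nat.card M))}

end Recognition

/-! ### Sharp-expressions -/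

/-- `♯`-expressions over a set of letters: letters, products and `ω♯`-powers. -/
inductive SharpExpr (A : Type*) where
  | letter (a : A) : SharpExpr A
  | mul (E F : SharpExpr A) : SharpExpr A
  | omegaSharp (E : SharpExpr A) : SharpExpr A

/-- Substitution of letters. -/
def SharpExpr.map {A B : Type*} (h : A → B) : SharpExpr A → SharpExpr B
  | .letter a => .letter (h a)
  | .mul E F => .mul (E.map h) (F.map h)
  | .omegaSharp E => .omegaSharp (E.map h)

/-- In a finite monoid `a ^ |M|!` is the idempotent power `a^ω` of `a`. -/
theorem isIdempotentElem_pow_factorial {M : Type*} [Monoid M] [Finite M] (a : M) :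
    IsIdempotentElem (a ^ (Nat.card M).factorial) := by
  have : Fintype M := Fintype.ofFinite M
  obtain ⟨i, j, hij, hne⟩ : ∃ i j : Fin (Nat.card M + 1), i < j ∧ a ^ (i : ℕ) = a ^ (j : ℕ) := by
    obtain ⟨x, y, hxy, h⟩ := Fintype.exists_ne_map_eq_of_card_lt
      (fun i : Fin (Nat.card M + 1) => a ^ (i : ℕ)) (by simp [Nat.card_eq_fintype_card])
    rcases lt_or_gt_of_ne hxy with h' | h'
    · exact ⟨x, y, h', h⟩
    · exact ⟨y, x, h', h.symm⟩
  obtain ⟨q, hq⟩ : ∃ q, (j : ℕ) = i + q := ⟨j - i, by have : (i : ℕ) < j := hij; omega⟩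
  have hi : (i : ℕ) < j := hij
  have hj : (j : ℕ) ≤ Nat.card M := Nat.lt_succ_iff.mp j.2
  have step : ∀ N, (i : ℕ) ≤ N → a ^ (N + q) = a ^ N := by
    intro N hN
    obtain ⟨r, rfl⟩ := Nat.exists_eq_add_of_le hN
    rw [show (i : ℕ) + r + q = i + q + r by ring, pow_add, ← hq, ← hne, ← pow_add]
  have steps : ∀ t N, (i : ℕ) ≤ N → a ^ (N + q * t) = a ^ N := by
    intro t
    induction t with
    | zero => intro N _; simp
    | succ t ih =>
      intro N hN
      rw [Nat.mul_succ, ← add_assoc, step _ (by omega), ih N hN]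
  obtain ⟨t, ht⟩ : q ∣ (Nat.card M).factorial := Nat.dvd_factorial (by omega) (by omega)
  have hle : (i : ℕ) ≤ (Nat.card M).factorial :=
    le_trans (by omega) (Nat.self_le_factorial (Nat.card M))
  have := steps t _ hle
  rw [← ht] at this
  rw [IsIdempotentElem, ← pow_add, this]

/-- The value in `M` of a `♯`-expression over `M`, with `a^{ω♯} = (a^ω)^♯`. -/
noncomputable def SharpExpr.val {M : Type*} [StabilisationMonoid M] : SharpExpr M → M
  | .letter a => a
  | .mul E F => E.val * F.val
  | .omegaSharp E => sharp (E.val ^ (Nat.card M).factorial)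

/-- `⟨X⟩^♯`: the set of values of `♯`-expressions over `X ⊆ M`. -/
def sharpClosure {M : Type*} [StabilisationMonoid M] (X : Set M) : Set M :=
  {a | ∃ E : SharpExpr X, (E.map Subtype.val).val = a}

/-- The `n`-unfolding of a `♯`-expression. -/
def SharpExpr.unfold {A : Type*} (n : ℕ) : SharpExpr A → List A
  | .letter a => [a]
  | .mul E F => E.unfold n ++ F.unfold n
  | .omegaSharp E => (List.replicate n (E.unfold n)).flatten

/-- The sequence of words `w 1, w 2, …` witnesses that `g` does not dominate `f`: `f` tends to
infinity along it, while `g` is bounded on it. -/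
def WitnessesNonDomination {A : Type*} (f g : List A → ℕ∞) (w : ℕ → List A) : Prop :=
  (∀ N : ℕ, ∃ n₀, ∀ n ≥ n₀, (N : ℕ∞) ≤ f (w n)) ∧ ∃ B : ℕ, ∀ n ≥ 1, g (w n) ≤ B

/-! ### Finite presentations of recognisers -/

/-- Finite data presenting a recogniser: the multiplication table, the order table, the unit, the
stabilisation table, the images of the letters and the indicator of the ideal. Elements of a
`k`-element monoid are named by the numbers `0, …, k - 1`. -/
abbrev RecogniserCode : Type :=
  List (List ℕ) × List (List Bool) × ℕ × List ℕ × List ℕ × List Bool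

open Classical in
/-- The presentation of `M, h, I` with respect to an enumeration `eM` of `M` and an enumeration
`eA` of the alphabet. -/
noncomputable def encode {A M : Type*} [StabilisationMonoid M] {m k : ℕ}
    (eA : Fin m ≃ A) (eM : Fin k ≃ M) (h : A → M) (I : Set M) : RecogniserCode :=
  (List.ofFn fun i => List.ofFn fun j => (eM.symm (eM i * eM j) : ℕ),
   List.ofFn fun i => List.ofFn fun j => decide (eM i ≤ eM j),
   (eM.symm 1 : ℕ),
   List.ofFn fun i => (eM.symm (sharp (eM i)) : ℕ),
   List.ofFn fun i => (eM.symm (h (eA i)) : ℕ),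
   List.ofFn fun i => decide (eM i ∈ I))

end StabilisationMonoid

namespace StabilisationMonoid

/-! ### Computations over intervals -/

section Intervals

variable {M : Type*} [StabilisationMonoid M]

/-! Two facts about computations carry the theorem. Existence (`exists_seg`): for every `n`, each
word has an `n`-computation of height at most `3|M|`. Uniqueness (`exists_threshold`): for fixed
heights, once `N` is large with respect to `n`, the value of an `n`-under-computation is below that
of any `N`-over-computation of the same word. Existence bounds the function `-` by `+`, and
uniqueness makes `++` dominated by `--`. The trivial comparisons close the cycle, so all four
functions define one cost function.

Uniqueness goes by induction on the over-computation, the under-computation being cut along its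
children at the price of tripling the height (`Under.pieces`). The crux is a stabilisation node over
many non-empty factors on which under-computations have value at most `e`. An under-computation of
bounded height over so many factors must itself stabilise some idempotent `f`. Two cuts with the
same pair of values make `f` comparable with `e` up to conjugation, and consistency of `♯` turns
`f♯` into `e♯` (`sharp_le_mul_sharp_mul`, `exists_sharp_bound`).

Existence is a factorisation forest argument, one class of mutual divisibility at a time. Inside a
class `J`, a colouring by `|J|` colours makes factors between equal colours share one idempotent
value, and costs three levels per colour. A stabilisation node over such factors either keeps its
value, because `e♯ = e`, or falls into a strictly lower ideal, where the construction goes on with a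
new budget of height.

For the criterion, values over non-empty words belong to `⟨h(A)⟩^♯`. Conversely the unfoldings of a
`♯`-expression have computations of its value, of fixed height and with arbitrarily large
thresholds. For decidability, both recognisers are pulled back to the product monoid, whose finite
closure is found by saturation. -/

instance : MulLeftMono M := ⟨fun a b c h => StabilisationMonoid.mul_le_mul a a b c le_rfl h⟩

instance : MulRightMono M := ⟨fun a b c h => StabilisationMonoid.mul_le_mul b c a a h le_rfl⟩

/-- `Seg R n w p x y v`: the factor `w x, …, w (y - 1)` of the infinite word `w` has a computation
with threshold `n`, height at most `p` and value `v`, node values being compared by `R`. Leaves may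
also carry the empty word, as if it were the letter `1`. -/
inductive Seg (R : M → M → Prop) (n : ℕ) (w : ℕ → M) : ℕ → ℕ → ℕ → M → Prop
  | nil (p x : ℕ) (v : M) : R v 1 → Seg R n w p x x v
  | leaf (p x : ℕ) (v : M) : R v (w x) → Seg R n w p x (x + 1) v
  | binary (p x y z : ℕ) (a b v : M) : Seg R n w p x y a → Seg R n w p y z b → R v (a * b) →
      Seg R n w (p + 1) x z v
  | idem (p k : ℕ) (C : ℕ → ℕ) (e v : M) : 2 ≤ k → k ≤ n → IsIdempotentElem e →
      (∀ i < k, Seg R n w p (C i) (C (i + 1)) e) → R v e → Seg R n w (p + 1) (C 0) (C k) v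
  | stab (p k : ℕ) (C : ℕ → ℕ) (e v : M) : n < k → IsIdempotentElem e →
      (∀ i < k, Seg R n w p (C i) (C (i + 1)) e) → R v (sharp e) →
      Seg R n w (p + 1) (C 0) (C k) v

variable {R : M → M → Prop} {n : ℕ} {w : ℕ → M}

theorem le_of_steps {C : ℕ → ℕ} {k : ℕ} (h : ∀ i < k, C i ≤ C (i + 1)) {i j : ℕ} (hij : i ≤ j)
    (hj : j ≤ k) : C i ≤ C j := by
  induction j, hij using Nat.le_induction with
  | base => exact le_rfl
  | succ j _ ih => exact (ih (by omega)).trans (h j (by omega))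

theorem Seg.le {p x y : ℕ} {v : M} (h : Seg R n w p x y v) : x ≤ y := by
  induction h with
  | nil => exact le_rfl
  | leaf => omega
  | binary _ _ _ _ _ _ _ _ _ _ h1 h2 => exact h1.trans h2
  | idem _ k _ _ _ _ _ _ _ _ ih => exact le_of_steps ih (Nat.zero_le k) le_rfl
  | stab _ k _ _ _ _ _ _ _ ih => exact le_of_steps ih (Nat.zero_le k) le_rfl

theorem Seg.mono {p q x y : ℕ} {v : M} (h : Seg R n w p x y v) (hpq : p ≤ q) :
    Seg R n w q x y v := by
  induction h generalizing q with
  | nil p x v h => exact .nil _ _ _ h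
  | leaf p x v h => exact .leaf _ _ _ h
  | binary p x y z a b v _ _ h ih1 ih2 =>
    obtain ⟨q, rfl⟩ : ∃ r, q = r + 1 := ⟨q - 1, by omega⟩
    exact .binary _ _ _ _ _ _ _ (ih1 (by omega)) (ih2 (by omega)) h
  | idem p k C e v h1 h2 he _ hv ih =>
    obtain ⟨q, rfl⟩ : ∃ r, q = r + 1 := ⟨q - 1, by omega⟩
    exact .idem _ _ _ _ _ h1 h2 he (fun i hi => ih i hi (by omega)) hv
  | stab p k C e v h1 he _ hv ih =>
    obtain ⟨q, rfl⟩ : ∃ r, q = r + 1 := ⟨q - 1, by omega⟩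
    exact .stab _ _ _ _ _ h1 he (fun i hi => ih i hi (by omega)) hv

theorem Seg.imp {R' : M → M → Prop} (hR : ∀ a b, R a b → R' a b) {p x y : ℕ} {v : M}
    (h : Seg R n w p x y v) : Seg R' n w p x y v := by
  induction h with
  | nil p x v h => exact .nil _ _ _ (hR _ _ h)
  | leaf p x v h => exact .leaf _ _ _ (hR _ _ h)
  | binary p x y z a b v _ _ h ih1 ih2 => exact .binary _ _ _ _ _ _ _ ih1 ih2 (hR _ _ h)
  | idem p k C e v h1 h2 he _ hv ih => exact .idem _ _ _ _ _ h1 h2 he ih (hR _ _ hv)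
  | stab p k C e v h1 he _ hv ih => exact .stab _ _ _ _ _ h1 he ih (hR _ _ hv)

/-- Substitution of computations for the letters of a word. -/
theorem Seg.subst {b : ℕ → M} {B : ℕ → ℕ} {q m : ℕ}
    (hB : ∀ i < m, Seg Eq n w q (B i) (B (i + 1)) (b i)) {p x y : ℕ} {v : M}
    (h : Seg Eq n b p x y v) (hy : y ≤ m) : Seg Eq n w (p + q) (B x) (B y) v := by
  induction h with
  | nil p x v h => exact .nil _ _ _ h
  | leaf p x v h => subst h; exact (hB x hy).mono (by omega)
  | binary p x y z a b v h1 h2 h ih1 ih2 =>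
    rw [show p + 1 + q = p + q + 1 by ring]
    exact .binary _ _ _ _ _ _ _ (ih1 (h2.le.trans hy)) (ih2 hy) h
  | idem p k C e v h1 h2 he hc hv ih =>
    rw [show p + 1 + q = p + q + 1 by ring]
    exact .idem _ _ (fun i => B (C i)) _ _ h1 h2 he
      (fun i hi => ih i hi ((le_of_steps (fun j hj => (hc j hj).le) hi le_rfl).trans hy)) hv
  | stab p k C e v h1 he hc hv ih =>
    rw [show p + 1 + q = p + q + 1 by ring]
    exact .stab _ _ (fun i => B (C i)) _ _ h1 he
      (fun i hi => ih i hi ((le_of_steps (fun j hj => (hc j hj).le) hi le_rfl).trans hy)) hv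

/-! ### Comparison with trees -/

theorem DeletesOnes.refl (u : List M) : DeletesOnes u u := by
  induction u with
  | nil => exact .nil
  | cons a u ih => exact .keep a ih

theorem DeletesOnes.append {v v' u u' : List M} (h : DeletesOnes v u) (h' : DeletesOnes v' u') :
    DeletesOnes (v ++ v') (u ++ u') := by
  induction h with
  | nil => exact h'
  | keep a _ ih => exact .keep a ih
  | delete _ ih => exact .delete ih

theorem DeletesOnes.exists_append {v v' u : List M} (h : DeletesOnes (v ++ v') u) :
    ∃ t t', u = t ++ t' ∧ DeletesOnes v t ∧ DeletesOnes v' t' := by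
  induction v generalizing u with
  | nil => exact ⟨[], u, rfl, .nil, h⟩
  | cons a v ih =>
    cases h with
    | keep _ h =>
      obtain ⟨t, t', rfl, h1, h2⟩ := ih h
      exact ⟨a :: t, t', rfl, .keep a h1, h2⟩
    | delete h =>
      obtain ⟨t, t', rfl, h1, h2⟩ := ih h
      exact ⟨t, t', rfl, .delete h1, h2⟩

theorem DeletesOnes.exists_ofFn {k : ℕ} {us : Fin k → List M} {u : List M}
    (h : DeletesOnes (List.ofFn us).flatten u) :
    ∃ us' : Fin k → List M, u = (List.ofFn us').flatten ∧ ∀ i, DeletesOnes (us i) (us' i) := by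
  induction k generalizing u with
  | zero => cases h; exact ⟨fun _ => [], by simp, fun i => i.elim0⟩
  | succ k ih =>
    rw [List.ofFn_succ, List.flatten_cons] at h
    obtain ⟨t, t', rfl, h1, h2⟩ := h.exists_append
    obtain ⟨us', rfl, h3⟩ := ih h2
    refine ⟨Fin.cons t us', by simp [List.ofFn_succ], fun i => ?_⟩
    refine Fin.cases ?_ (fun j => ?_) i
    · simpa using h1
    · simpa using h3 j

theorem DeletesOnes.ofFn {k : ℕ} {us us' : Fin k → List M} (h : ∀ i, DeletesOnes (us i) (us' i)) :
    DeletesOnes (List.ofFn us).flatten (List.ofFn us').flatten := by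
  induction k with
  | zero => simpa using DeletesOnes.nil
  | succ k ih =>
    simp only [List.ofFn_succ, List.flatten_cons]
    exact (h 0).append (ih fun i => h i.succ)

/-- The word `u` occurs in `w` at the position `x`. -/
def OccursAt (w : ℕ → M) (x : ℕ) (u : List M) : Prop :=
  (List.Ico x (x + u.length)).map w = u

theorem occursAt_append {M : Type*} {w : ℕ → M} {x : ℕ} {u v : List M} :
    OccursAt w x (u ++ v) ↔ OccursAt w x u ∧ OccursAt w (x + u.length) v := by
  unfold OccursAt
  rw [List.length_append, ← add_assoc,
    ← List.Ico.append_consecutive (Nat.le_add_right x u.length) (Nat.le_add_right _ v.length),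
    List.map_append]
  constructor
  · intro h
    exact List.append_inj h (by simp)
  · rintro ⟨h1, h2⟩
    rw [h1, h2]

theorem OccursAt.exists_boundaries {M : Type*} {w : ℕ → M} {k : ℕ} {us : Fin k → List M} {x : ℕ}
    (h : OccursAt w x (List.ofFn us).flatten) :
    ∃ C : ℕ → ℕ, C 0 = x ∧ C k = x + (List.ofFn us).flatten.length ∧
      ∀ i : Fin k, C (i + 1) = C i + (us i).length ∧ OccursAt w (C i) (us i) := by
  induction k generalizing x with
  | zero => exact ⟨fun _ => x, rfl, by simp, fun i => i.elim0⟩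
  | succ k ih =>
    rw [List.ofFn_succ, List.flatten_cons, occursAt_append] at h
    obtain ⟨C, h0, hk, hC⟩ := ih h.2
    refine ⟨fun i => Nat.casesOn i x C, rfl, ?_, fun i => ?_⟩
    · simp only [hk, List.ofFn_succ, List.flatten_cons, List.length_append]
      omega
    · refine Fin.cases ?_ (fun j => ?_) i
      · exact ⟨h0, h.1⟩
      · exact hC j

theorem Seg.of_isComp {p : ℕ} {T : CompTree M} {v u : List M} (hT : IsComp R n T v)
    (hp : T.height ≤ p) (hd : DeletesOnes v u) {x : ℕ} (hu : OccursAt w x u) :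
    Seg R n w p x (x + u.length) T.value := by
  induction T generalizing p v u x with
  | leaf a =>
    obtain ⟨b, rfl, hb⟩ := hT
    cases hd with
    | keep _ h =>
      cases h
      refine .leaf _ _ _ ?_
      have : w x = b := by simpa [OccursAt] using hu
      rwa [this]
    | delete h =>
      cases h
      exact .nil _ _ _ hb
  | node a k c ih =>
    obtain ⟨⟨us, rfl, hus⟩, hk⟩ := hT
    obtain ⟨us', rfl, hd'⟩ := hd.exists_ofFn
    obtain ⟨C, h0, hCk, hC⟩ := hu.exists_boundaries
    obtain ⟨q, rfl⟩ : ∃ q, p = q + 1 := ⟨p - 1, by simp only [CompTree.height] at hp; omega⟩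
    have hq : ∀ i, (c i).height ≤ q := fun i => by
      have := Finset.le_sup (f := fun i => (c i).height) (Finset.mem_univ i)
      simp only [CompTree.height] at hp
      omega
    have hseg : ∀ i : Fin k, Seg R n w q (C i) (C (i + 1)) (c i).value := fun i => by
      rw [(hC i).1]
      exact ih i (hus i) (hq i) (hd' i) (hC i).2
    rw [← hCk, ← h0]
    rcases hk with ⟨rfl, hv⟩ | ⟨h2, hn, e, he, hce, hv⟩ | ⟨hn, e, he, hce, hv⟩
    · have h1 := hseg 0
      have h2 := hseg 1
      refine .binary _ _ _ _ _ _ _ h1 h2 ?_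
      simpa [List.ofFn_succ, CompTree.value] using hv
    · exact .idem _ _ _ _ _ h2 hn he (fun i hi => hce ⟨i, hi⟩ ▸ hseg ⟨i, hi⟩) hv
    · exact .stab _ _ _ _ _ hn he (fun i hi => hce ⟨i, hi⟩ ▸ hseg ⟨i, hi⟩) hv

theorem map_Ico_eq_flatten {M : Type*} {w : ℕ → M} {C : ℕ → ℕ} {k : ℕ}
    (h : ∀ i < k, C i ≤ C (i + 1)) :
    (List.Ico (C 0) (C k)).map w =
      (List.ofFn fun i : Fin k => (List.Ico (C i) (C (i + 1))).map w).flatten := by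
  induction k with
  | zero => simp
  | succ k ih =>
    rw [List.ofFn_succ', List.concat_eq_append, List.flatten_append]
    simp only [Fin.val_castSucc, Fin.val_last, List.flatten_cons, List.flatten_nil,
      List.append_nil]
    rw [← ih fun i hi => h i (by omega), ← List.map_append, List.Ico.append_consecutive
      (le_of_steps h (Nat.zero_le k) (by omega)) (h k (by omega))]

theorem Seg.exists_tree {p x y : ℕ} {v : M} (h : Seg R n w p x y v) :
    ∃ (u : List M) (T : CompTree M), DeletesOnes u ((List.Ico x y).map w) ∧ IsComp R n T u ∧
      T.height ≤ p ∧ T.value = v := by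
  induction h with
  | nil p x v h =>
    refine ⟨[1], .leaf v, ?_, ⟨1, rfl, h⟩, Nat.zero_le _, rfl⟩
    simpa using DeletesOnes.delete DeletesOnes.nil
  | leaf p x v h =>
    exact ⟨[w x], .leaf v, by simpa using DeletesOnes.refl _, ⟨w x, rfl, h⟩, Nat.zero_le _, rfl⟩
  | binary p x y z a b v h1 h2 h ih1 ih2 =>
    obtain ⟨u, T, hd, hT, hp, rfl⟩ := ih1
    obtain ⟨u', T', hd', hT', hp', rfl⟩ := ih2
    refine ⟨u ++ u', .node v 2 ![T, T'], ?_, ⟨⟨![u, u'], by simp [List.ofFn_succ], ?_⟩, ?_⟩, ?_, rfl⟩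
    · rw [← List.Ico.append_consecutive h1.le h2.le, List.map_append]
      exact hd.append hd'
    · intro i
      fin_cases i
      · exact hT
      · exact hT'
    · left
      exact ⟨rfl, by simpa [List.ofFn_succ] using h⟩
    · simp only [CompTree.height, add_le_add_iff_right, Finset.sup_le_iff]
      intro i _
      fin_cases i
      · exact hp
      · exact hp'
  | idem p k C e v h1 h2 he hc hv ih =>
    choose u T hd hT hp hval using fun i : Fin k => ih i i.2
    refine ⟨(List.ofFn u).flatten, .node v k T, ?_, ⟨⟨u, rfl, hT⟩, ?_⟩, ?_, rfl⟩
    · rw [map_Ico_eq_flatten fun i hi => (hc i hi).le]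
      exact DeletesOnes.ofFn hd
    · exact .inr (.inl ⟨h1, h2, e, he, hval, hv⟩)
    · simpa only [CompTree.height, add_le_add_iff_right, Finset.sup_le_iff] using fun i _ => hp i
  | stab p k C e v h1 he hc hv ih =>
    choose u T hd hT hp hval using fun i : Fin k => ih i i.2
    refine ⟨(List.ofFn u).flatten, .node v k T, ?_, ⟨⟨u, rfl, hT⟩, ?_⟩, ?_, rfl⟩
    · rw [map_Ico_eq_flatten fun i hi => (hc i hi).le]
      exact DeletesOnes.ofFn hd
    · exact .inr (.inr ⟨h1, e, he, hval, hv⟩)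
    · simpa only [CompTree.height, add_le_add_iff_right, Finset.sup_le_iff] using fun i _ => hp i

/-- The infinite word that continues `u` by letters `1`. -/
def extend (u : List M) (i : ℕ) : M := u.getD i 1

theorem map_extend (u : List M) : (List.Ico 0 u.length).map (extend u) = u := by
  apply List.ext_getElem
  · simp
  · intro i h1 h2
    simp [extend, List.Ico.zero_bot, h2]

/-- Computations can be handled on intervals of positions: cuts become natural numbers, and the
deleted letters `1` become leaves over empty intervals. -/
theorem hasComp_iff {p : ℕ} {u : List M} {X : Set M} :
    HasComp R n p u X ↔ ∃ v ∈ X, Seg R n (extend u) p 0 u.length v := by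
  constructor
  · rintro ⟨v, T, hd, hT, hp, hX⟩
    refine ⟨_, hX, ?_⟩
    have := Seg.of_isComp (w := extend u) (x := 0) hT hp hd (by simpa [OccursAt] using map_extend u)
    simpa using this
  · rintro ⟨v, hv, h⟩
    obtain ⟨u', T, hd, hT, hp, rfl⟩ := h.exists_tree
    rw [map_extend] at hd
    exact ⟨u', T, hd, hT, hp, hv⟩

end Intervals

end StabilisationMonoid

namespace StabilisationMonoid

/-! ### Uniqueness of values, up to a change of threshold. -/

section Uniqueness

variable {M : Type*} [StabilisationMonoid M]

/-! ### Products of factors, and basic identities -/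

/-- The product of the letters `w x, …, w (y - 1)`. -/
def iprod (w : ℕ → M) (x y : ℕ) : M := ((List.Ico x y).map w).prod

@[simp] theorem iprod_self (w : ℕ → M) (x : ℕ) : iprod w x x = 1 := by simp [iprod]

@[simp] theorem iprod_succ (w : ℕ → M) (x : ℕ) : iprod w x (x + 1) = w x := by simp [iprod]

theorem iprod_mul (w : ℕ → M) {x y z : ℕ} (hxy : x ≤ y) (hyz : y ≤ z) :
    iprod w x y * iprod w y z = iprod w x z := by
  rw [iprod, iprod, iprod, ← List.Ico.append_consecutive hxy hyz, List.map_append, List.prod_append]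

theorem sharp_eq_mul_mul {e : M} (he : IsIdempotentElem e) : sharp e = e * sharp e * e := by
  have := sharp_consistent e e (by rwa [he.eq]) (by rwa [he.eq])
  rwa [he.eq] at this

theorem mul_sharp {e : M} (he : IsIdempotentElem e) : e * sharp e = sharp e := by
  rw [sharp_eq_mul_mul he, ← mul_assoc, ← mul_assoc, he.eq]

theorem sharp_mul {e : M} (he : IsIdempotentElem e) : sharp e * e = sharp e := by
  rw [sharp_eq_mul_mul he, mul_assoc, he.eq]

theorem pow_le_of_le {e a : M} (he : IsIdempotentElem e) (h : a ≤ e) {k : ℕ} (hk : k ≠ 0) :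
    a ^ k ≤ e := by
  calc a ^ k ≤ e ^ k := pow_le_pow_left' h k
    _ = e := he.pow_eq hk

theorem le_pow_of_le {e a : M} (he : IsIdempotentElem e) (h : e ≤ a) {k : ℕ} (hk : k ≠ 0) :
    e ≤ a ^ k := by
  calc e = e ^ k := (he.pow_eq hk).symm
    _ ≤ a ^ k := pow_le_pow_left' h k

/-- The algebraic core of the uniqueness of values: the stabilisation of `f` can be transferred to
an idempotent `e` conjugated with it. -/
theorem sharp_le_mul_sharp_mul {e f l r : M} (he : IsIdempotentElem e) (hf : IsIdempotentElem f)
    (hlr : f ≤ l * r) (hrl : r * sharp f * l ≤ e) : sharp f ≤ l * sharp e * r := by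
  have : Finite M := StabilisationMonoid.finite
  set g := sharp f with hg
  have hgi : IsIdempotentElem g := sharp_idempotent f hf
  have hgf : g ≤ f := sharp_le f hf
  have hgs : sharp g = g := sharp_sharp f hf
  have hfg : f * g = g := mul_sharp hf
  have hgf' : g * f = g := sharp_mul hf
  obtain ⟨ω, hω⟩ : ∃ ω, (Nat.card M).factorial = ω + 1 :=
    ⟨_, (Nat.succ_pred_eq_of_pos (Nat.factorial_pos _)).symm⟩
  -- With `a = g l` and `b = r g` one has `g ≤ ab` and `ba ≤ e`. At idempotent powers, consistency
  -- moves `♯` from `ab` to `ba`, where it is bounded by `e♯`. The surplus powers and factors `g`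
  -- then disappear because `r g l ≤ e` and `e` is absorbed by `e♯`.
  set a := g * l with ha
  set b := r * g with hb
  have hab : g ≤ a * b := by
    calc g = g * f * g := by rw [hgf', hgi.eq]
      _ ≤ g * (l * r) * g := by gcongr
      _ = a * b := by simp only [ha, hb, mul_assoc]
  have hba : b * a ≤ e := by
    calc b * a = r * (g * g) * l := by simp only [ha, hb, mul_assoc]
      _ ≤ e := by rwa [hgi.eq]
  have i1 : IsIdempotentElem ((a * b) ^ (ω + 1)) := hω ▸ isIdempotentElem_pow_factorial (a * b)
  have i2 : IsIdempotentElem ((b * a) ^ (ω + 1)) := hω ▸ isIdempotentElem_pow_factorial (b * a)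
  have e1 : a * (b * (a * b) ^ ω) = (a * b) ^ (ω + 1) := by rw [← mul_assoc, pow_succ']
  have e2 : b * (a * b) ^ ω * a = (b * a) ^ (ω + 1) := by
    rw [pow_succ, ← mul_assoc ((b * a) ^ ω), ← mul_pow_mul b a ω]
  have h1 : g ≤ a * sharp e * (b * (a * b) ^ ω) := by
    calc g = sharp g := hgs.symm
      _ ≤ sharp ((a * b) ^ (ω + 1)) :=
        sharp_mono _ _ hgi i1 (le_pow_of_le hgi hab (Nat.succ_ne_zero _))
      _ = a * sharp ((b * a) ^ (ω + 1)) * (b * (a * b) ^ ω) := by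
        rw [← e1, ← e2]
        exact sharp_consistent _ _ (by rwa [e1]) (by rwa [e2])
      _ ≤ _ := by
        gcongr
        exact sharp_mono _ _ i2 he (pow_le_of_le he hba (Nat.succ_ne_zero _))
  have h2 : g ≤ a * sharp e * b := by
    calc g = g * g := hgi.eq.symm
      _ ≤ a * sharp e * (b * (a * b) ^ ω) * (a * b) := by gcongr
      _ = a * sharp e * (b * (a * b) ^ ω * a) * b := by simp only [mul_assoc]
      _ ≤ a * sharp e * e * b := by
        rw [e2]
        gcongr
        exact pow_le_of_le he hba (Nat.succ_ne_zero _)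
      _ = a * sharp e * b := by rw [mul_assoc a, sharp_mul he]
  have h3 : g ≤ l * sharp e * b := by
    calc g = f * g := hfg.symm
      _ ≤ l * r * (a * sharp e * b) := by gcongr
      _ = l * (r * g * l) * sharp e * b := by simp only [ha, mul_assoc]
      _ ≤ l * e * sharp e * b := by gcongr
      _ = l * sharp e * b := by rw [mul_assoc l, mul_sharp he]
  calc g = g * f := hgf'.symm
    _ ≤ l * sharp e * b * (l * r) := by gcongr
    _ = l * sharp e * (r * g * l) * r := by simp only [hb, mul_assoc]
    _ ≤ l * sharp e * e * r := by gcongr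
    _ = l * sharp e * r := by rw [mul_assoc l, sharp_mul he]

/-! ### Under-computations and their decomposition -/

/-- Under-computations over intervals. -/
abbrev Under (n : ℕ) (w : ℕ → M) (p x y : ℕ) (a : M) : Prop := Seg (· ≤ ·) n w p x y a

variable {n : ℕ} {w : ℕ → M}

theorem Under.mono {p q x y : ℕ} {a : M} (h : Under n w p x y a) (hpq : p ≤ q) :
    Under n w q x y a :=
  Seg.mono h hpq

theorem Under.mul {p x y z : ℕ} {a b : M} (h : Under n w p x y a) (h' : Under n w p y z b) :
    Under n w (p + 1) x z (a * b) :=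
  .binary _ _ _ _ _ _ _ h h' le_rfl

theorem under_one {p x : ℕ} : Under n w p x x 1 := .nil _ _ _ le_rfl

theorem le_iprod_of_steps {C : ℕ → ℕ} {k : ℕ} {e : M} (he : IsIdempotentElem e)
    (hC : ∀ i < k, C i ≤ C (i + 1)) (h : ∀ i < k, e ≤ iprod w (C i) (C (i + 1))) (hk : 1 ≤ k) :
    e ≤ iprod w (C 0) (C k) := by
  induction k, hk using Nat.le_induction with
  | base => exact h 0 (by omega)
  | succ k hk ih =>
    rw [← iprod_mul w (le_of_steps hC (Nat.zero_le k) (by omega)) (hC k (by omega))]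
    calc e = e * e := he.eq.symm
      _ ≤ _ := mul_le_mul' (ih (fun i hi => hC i (by omega)) fun i hi => h i (by omega))
        (h k (by omega))

theorem Under.le_iprod {p x y : ℕ} {a : M} (h : Under n w p x y a) : a ≤ iprod w x y := by
  induction h with
  | nil p x v h => simpa using h
  | leaf p x v h => simpa using h
  | binary p x y z a b v h1 h2 h ih1 ih2 =>
    rw [← iprod_mul w h1.le h2.le]
    exact h.trans (mul_le_mul' ih1 ih2)
  | idem p k C e v h1 h2 he hc hv ih =>
    exact hv.trans (le_iprod_of_steps he (fun i hi => (hc i hi).le) ih (by omega))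
  | stab p k C e v h1 he hc hv ih =>
    exact (hv.trans (sharp_le e he)).trans
      (le_iprod_of_steps he (fun i hi => (hc i hi).le) ih (by omega))

theorem Under.le_one {p x : ℕ} {a : M} (h : Under n w p x x a) : a ≤ 1 := by
  simpa using h.le_iprod

/-- The data common to idempotent and stabilisation nodes with `k` children of value `e`; here `z`
is the value prescribed for the node. -/
structure IsNodeValue (n k : ℕ) (e z : M) : Prop where
  idem : IsIdempotentElem e
  pos : 1 ≤ k
  eq : z = e ∧ k ≤ n ∨ z = sharp e ∧ n < k

namespace IsNodeValue

variable {k : ℕ} {e z : M}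

theorem mul_self (h : IsNodeValue n k e z) : z * z = z := by
  rcases h.eq with ⟨rfl, _⟩ | ⟨rfl, _⟩
  · exact h.idem.eq
  · exact (sharp_idempotent e h.idem).eq

theorem le (h : IsNodeValue n k e z) : z ≤ e := by
  rcases h.eq with ⟨rfl, _⟩ | ⟨rfl, _⟩
  · exact le_rfl
  · exact sharp_le e h.idem

/-- Consecutive children of a node have a common value above the one prescribed for the node. -/
theorem exists_block (h : IsNodeValue n k e z) {C : ℕ → ℕ} {p : ℕ}
    (hC : ∀ i < k, Under n w p (C i) (C (i + 1)) e) {i j : ℕ} (hij : i < j) (hj : j ≤ k) :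
    ∃ c, z ≤ c ∧ Under n w (p + 1) (C i) (C j) c := by
  obtain ⟨d, rfl⟩ : ∃ d, j = i + d := ⟨j - i, by omega⟩
  have hC' : ∀ t < d, Under n w p (C (i + t)) (C (i + (t + 1))) e := fun t ht => hC _ (by omega)
  by_cases hd : d = 1
  · subst hd
    exact ⟨e, h.le, (hC i (by omega)).mono (by omega)⟩
  by_cases hdn : d ≤ n
  · exact ⟨e, h.le, .idem p d (fun t => C (i + t)) e e (by omega) hdn h.idem hC' le_rfl⟩
  · refine ⟨sharp e, ?_, .stab p d (fun t => C (i + t)) e _ (by omega) h.idem hC' le_rfl⟩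
    rcases h.eq with ⟨rfl, _⟩ | ⟨rfl, _⟩
    · omega
    · exact le_rfl

end IsNodeValue

theorem Under.cases_succ {p x y : ℕ} {v : M} (h : Under n w (p + 1) x y v) :
    y ≤ x + 1 ∨ (∃ c a b, Under n w p x c a ∧ Under n w p c y b ∧ v ≤ a * b) ∨
    ∃ (k : ℕ) (C : ℕ → ℕ) (e z : M), IsNodeValue n k e z ∧ C 0 = x ∧ C k = y ∧
      (∀ i < k, Under n w p (C i) (C (i + 1)) e) ∧ v ≤ z := by
  cases h with
  | nil => left; omega
  | leaf => left; omega
  | binary p x y z a b v h1 h2 h => exact .inr (.inl ⟨_, _, _, h1, h2, h⟩)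
  | idem p k C e v h1 h2 he hc hv =>
    exact .inr (.inr ⟨k, C, e, e, ⟨he, by omega, .inl ⟨rfl, h2⟩⟩, rfl, rfl, hc, hv⟩)
  | stab p k C e v h1 he hc hv =>
    exact .inr (.inr ⟨k, C, e, _, ⟨he, by omega, .inr ⟨rfl, h1⟩⟩, rfl, rfl, hc, hv⟩)

/-- `Pieces n w q B i j v`: the factors of `w` between the consecutive boundaries `B i, …, B j` have
under-computations of height at most `q` the product of whose values is above `v`. -/
inductive Pieces (n : ℕ) (w : ℕ → M) (q : ℕ) (B : ℕ → ℕ) (i : ℕ) : ℕ → M → Prop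
  | nil (v : M) : v ≤ 1 → Pieces n w q B i i v
  | snoc (j : ℕ) (v a v' : M) : Pieces n w q B i j v → Under n w q (B j) (B (j + 1)) a →
      v' ≤ v * a → Pieces n w q B i (j + 1) v'

namespace Pieces

variable {q : ℕ} {B : ℕ → ℕ} {i j k : ℕ} {v v' : M}

theorem le (h : Pieces n w q B i j v) : i ≤ j := by
  induction h with
  | nil => exact le_rfl
  | snoc _ _ _ _ _ _ _ ih => omega

theorem mono {q' : ℕ} (h : Pieces n w q B i j v) (hq : q ≤ q') : Pieces n w q' B i j v := by
  induction h with
  | nil v h => exact .nil _ h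
  | snoc j v a v' _ ha hv ih => exact .snoc _ _ _ _ ih (ha.mono hq) hv

theorem down (h : Pieces n w q B i j v) (hv : v' ≤ v) : Pieces n w q B i j v' := by
  cases h with
  | nil v h => exact .nil _ (hv.trans h)
  | snoc j v a v' h ha h' => exact .snoc _ _ _ _ h ha (hv.trans h')

theorem append (h : Pieces n w q B i j v) (h' : Pieces n w q B j k v') :
    Pieces n w q B i k (v * v') := by
  induction h' with
  | nil u hu => exact h.down (mul_le_of_le_one_right' hu)
  | snoc k u a u' _ ha hu ih =>
    refine .snoc _ _ _ _ ih ha ?_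
    rw [mul_assoc]
    exact mul_le_mul' le_rfl hu

theorem single {a : M} (h : Under n w q (B i) (B (i + 1)) a) : Pieces n w q B i (i + 1) a :=
  .snoc _ 1 _ _ (.nil _ le_rfl) h (one_mul a).ge

theorem uncons (h : Pieces n w q B i j v) (hij : i < j) :
    ∃ a v', Under n w q (B i) (B (i + 1)) a ∧ Pieces n w q B (i + 1) j v' ∧ v ≤ a * v' := by
  induction h with
  | nil => omega
  | snoc j u a u' h ha hu ih =>
    rcases h.le.eq_or_lt with rfl | hlt
    · cases h with
      | nil _ h1 => exact ⟨a, 1, ha, .nil _ le_rfl,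
          hu.trans ((mul_le_of_le_one_left' h1).trans (mul_one a).ge)⟩
      | snoc j _ _ _ h => have := h.le; omega
    · obtain ⟨b, c, hb, hc, hle⟩ := ih hlt
      refine ⟨b, c * a, hb, .snoc _ _ _ _ hc ha le_rfl, ?_⟩
      rw [← mul_assoc]
      exact hu.trans (mul_le_mul' hle le_rfl)

theorem unsnoc (h : Pieces n w q B i (j + 1) v) (hij : i ≤ j) :
    ∃ v' a, Pieces n w q B i j v' ∧ Under n w q (B j) (B (j + 1)) a ∧ v ≤ v' * a := by
  cases h with
  | nil => omega
  | snoc _ v' a _ h ha hv => exact ⟨v', a, h, ha, hv⟩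

/-- Allows boundaries to be replaced by others that agree with them on the range, in particular
after clamping to a child. -/
theorem reindex {B' : ℕ → ℕ} {d i' j' : ℕ} (h : Pieces n w q B' i' j' v) (hi : i' = i + d)
    (hj : j' = j + d) (hB : ∀ t, i ≤ t → t ≤ j → B' (t + d) = B t) : Pieces n w q B i j v := by
  induction h generalizing j with
  | nil v h =>
    obtain rfl : i = j := by omega
    exact .nil _ h
  | snoc j' v a v' h ha hv ih =>
    have := h.le
    obtain ⟨j, rfl⟩ : ∃ r, j = r + 1 := ⟨j - 1, by omega⟩
    obtain rfl : j' = j + d := by omega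
    refine .snoc _ _ _ _ (ih rfl fun t h1 h2 => hB t h1 (by omega)) ?_ hv
    rw [← hB j (by omega) (by omega), ← hB (j + 1) (by omega) (by omega)]
    convert ha using 2
    omega

/-- If all the pieces have values at most `e`, so has a non-empty sequence of pieces. -/
theorem le_idem {e : M} (he : IsIdempotentElem e)
    (hB : ∀ t, i ≤ t → t < j → ∀ a, Under n w q (B t) (B (t + 1)) a → a ≤ e)
    (h : Pieces n w q B i j v) : v ≤ e ∨ i = j ∧ v ≤ 1 := by
  induction h with
  | nil v h => exact .inr ⟨rfl, h⟩
  | snoc j v a v' h ha hv ih =>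
    left
    have h1 := hB j h.le (by omega) a ha
    rcases ih fun t h1 h2 => hB t h1 (by omega) with h2 | ⟨_, h2⟩
    · exact hv.trans ((mul_le_mul' h2 h1).trans he.eq.le)
    · exact hv.trans ((mul_le_mul' h2 h1).trans (one_mul e).le)

end Pieces

theorem pieces_of_eq {q : ℕ} {B : ℕ → ℕ} (hB : Monotone B) {i j : ℕ} (hij : i ≤ j)
    (h : B j ≤ B i) : Pieces n w q B i j 1 := by
  induction j, hij using Nat.le_induction with
  | base => exact .nil _ le_rfl
  | succ j hij ih =>
    have h1 : B j = B (j + 1) :=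
      le_antisymm (hB (Nat.le_succ j)) (h.trans (hB hij))
    refine .snoc _ 1 1 _ (ih (h1.trans_le h)) ?_ (one_mul 1).ge
    rw [← h1]
    exact under_one

/-- Distributing the children of a node over pieces, from left to right: the last piece started
before the boundary `C κ` consists of a part of a child followed by complete children. -/
theorem exists_pieces_prefix {p k : ℕ} {B C : ℕ → ℕ} {e z : M} (hB : Monotone B)
    (hz : IsNodeValue n k e z) (hC : ∀ t < k, Under n w p (C t) (C (t + 1)) e)
    (hs : ∀ t < k, ∀ B' : ℕ → ℕ, Monotone B' → ∀ i j, i ≤ j → B' i = C t → B' j = C (t + 1) →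
      Pieces n w (3 * p) B' i j e)
    {i : ℕ} (hi : B i = C 0) {κ : ℕ} (hκ : κ ≤ k) {j : ℕ} (hij : i ≤ j) (hj : B j ≤ C κ)
    (hj' : C κ ≤ B (j + 1)) :
    ∃ v x m, m ≤ κ ∧ Pieces n w (3 * p + 3) B i j v ∧ Under n w (3 * p) (B j) (C m) x ∧
      (∀ t, z ≤ t → z ≤ v * x * (if m = κ then 1 else z) * t) ∧
      (0 < κ → z ≤ v * x * (if m = κ then 1 else z)) := by
  -- Invariant: `v` is the value of the closed pieces, `x` that of the part of a child which begins
  -- the open piece, and the factor `1` or `z` stands for the complete children `m, …, κ - 1`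
  -- waiting in it. For `κ = 0` nothing is yet above `z`, hence the form quantified over the
  -- remaining factor `t`.
  have hCle : ∀ t < k, C t ≤ C (t + 1) := fun t ht => (hC t ht).le
  induction κ generalizing j with
  | zero =>
    refine ⟨1, 1, 0, le_rfl, pieces_of_eq hB hij (hi ▸ hj), ?_, by simp, by simp⟩
    rw [← hi, le_antisymm (hi ▸ hj : B j ≤ B i) (hB hij)]
    exact under_one
  | succ κ ih =>
    have hκk : κ < k := by omega
    suffices h : ∃ v x m, m ≤ κ + 1 ∧ Pieces n w (3 * p + 3) B i j v ∧
        Under n w (3 * p) (B j) (C m) x ∧ z ≤ v * x * (if m = κ + 1 then 1 else z) by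
      obtain ⟨v, x, m, h1, h2, h3, h4⟩ := h
      refine ⟨v, x, m, h1, h2, h3, fun t ht => ?_, fun _ => h4⟩
      calc z = z * z := hz.mul_self.symm
        _ ≤ _ := mul_le_mul' h4 ht
    -- Either child `κ` lies within the open piece and joins the waiting children, at no cost since
    -- `z z = z`, or the boundary `B j` lies beyond its left end and the child is decomposed.
    by_cases hjκ : B j ≤ C κ
    · obtain ⟨v, x, m, h1, h2, h3, h4, _⟩ := ih (by omega) hij hjκ ((hCle κ hκk).trans hj')
      refine ⟨v, x, m, by omega, h2, h3, ?_⟩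
      rw [if_neg (by omega)]
      have h5 := h4 z le_rfl
      split_ifs at h5 with hm
      · simpa using h5
      · rwa [mul_assoc _ z z, hz.mul_self] at h5
    · have hex : ∃ l, i ≤ l ∧ C κ ≤ B (l + 1) := ⟨j, hij, by
        have := hB (Nat.le_succ j); simp only [Nat.succ_eq_add_one] at this; omega⟩
      classical
      obtain ⟨hl1, hl2⟩ := Nat.find_spec hex
      have hmin := fun l hl => Nat.find_min (m := l) hex hl
      set l := Nat.find hex with hl
      have hl3 : B l ≤ C κ := by
        rcases hl1.eq_or_lt with h | h
        · rw [← h, hi]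
          exact le_of_steps hCle (Nat.zero_le κ) (by omega)
        · by_contra hcon
          refine hmin (l - 1) (by omega) ⟨by omega, ?_⟩
          rw [show l - 1 + 1 = l by omega]
          omega
      have hlj : l < j := by
        by_contra hcon
        exact hjκ ((hB (not_lt.mp hcon)).trans hl3)
      obtain ⟨v, x, m, h1, h2, h3, h4, _⟩ := ih (by omega) hl1 hl3 hl2
      -- The boundaries are clamped to child `κ`: its first part closes piece `l`, its last part
      -- opens piece `j`, and the pieces in between are genuine ones.
      set B' : ℕ → ℕ := fun t => max (C κ) (min (B t) (C (κ + 1))) with hB'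
      have hBm : Monotone B' := fun a b hab =>
        max_le_max le_rfl (min_le_min (hB hab) le_rfl)
      have hsub := hCle κ hκk
      have hmid : ∀ t, l + 1 ≤ t → t ≤ j → B' t = B t := fun t ht1 ht2 => by
        have h5 := hB ht1
        have h6 := hB ht2
        simp only [hB']
        omega
      have hp := hs κ hκk B' hBm l (j + 1) (by omega) (by simp only [hB']; omega)
        (by simp only [hB']; omega)
      obtain ⟨v1, x1, hp, hx1, hle⟩ := hp.unsnoc hlj.le
      obtain ⟨a0, v2, ha0, hv2, hle2⟩ := hp.uncons hlj
      rw [hmid (l + 1) le_rfl (by omega), show B' l = C κ by simp only [hB']; omega] at ha0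
      rw [hmid j (by omega) le_rfl, show B' (j + 1) = C (κ + 1) by simp only [hB']; omega] at hx1
      have hv2' : Pieces n w (3 * p) B (l + 1) j v2 :=
        hv2.reindex (d := 0) rfl rfl fun t ht1 ht2 => hmid t ht1 ht2
      have hpiece : ∃ c, Under n w (3 * p + 3) (B l) (B (l + 1)) c ∧
          x * (if m = κ then 1 else z) * a0 ≤ c := by
        split_ifs with hm
        · subst hm
          exact ⟨x * a0, (h3.mul ha0).mono (by omega), by simp⟩
        · obtain ⟨c, hc, hc'⟩ := hz.exists_block hC (show m < κ by omega) (by omega)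
          refine ⟨x * c * a0, ?_, by gcongr⟩
          -- The block has height `p + 1 ≤ 3p + 1`. Two binary nodes attach the parts of children on
          -- its sides, whence three levels per level of the original tree.
          exact ((((h3.mono (by omega : 3 * p ≤ 3 * p + 1)).mul
            (hc'.mono (by omega))).mul (ha0.mono (by omega))).mono (by omega))
      obtain ⟨c, hc, hc'⟩ := hpiece
      refine ⟨v * c * v2, x1, κ + 1, le_rfl,
        (h2.append (.single hc)).append (hv2'.mono (by omega)), hx1, ?_⟩
      rw [if_pos rfl, mul_one]
      calc z ≤ v * x * (if m = κ then 1 else z) * (a0 * v2 * x1) :=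
            h4 _ (hz.le.trans (hle.trans (mul_le_mul' hle2 le_rfl)))
        _ = v * (x * (if m = κ then 1 else z) * a0) * v2 * x1 := by simp only [mul_assoc]
        _ ≤ v * c * v2 * x1 := by gcongr

/-- At the right end the open piece covers an empty factor, so whatever is left in it has value at
most `1` and can be dropped. -/
theorem IsNodeValue.pieces {p k : ℕ} {B C : ℕ → ℕ} {e z : M} (hB : Monotone B)
    (hz : IsNodeValue n k e z) (hC : ∀ t < k, Under n w p (C t) (C (t + 1)) e)
    (hs : ∀ t < k, ∀ B' : ℕ → ℕ, Monotone B' → ∀ i j, i ≤ j → B' i = C t → B' j = C (t + 1) →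
      Pieces n w (3 * p) B' i j e)
    {i j : ℕ} (hij : i ≤ j) (hi : B i = C 0) (hj : B j = C k) :
    Pieces n w (3 * (p + 1)) B i j z := by
  obtain ⟨v, x, m, h1, h2, h3, _, h4⟩ := exists_pieces_prefix hB hz hC hs hi le_rfl hij hj.le
    (hj ▸ hB (Nat.le_succ j))
  have hCle : ∀ t < k, C t ≤ C (t + 1) := fun t ht => (hC t ht).le
  have hmk : C m = B j := le_antisymm (hj ▸ le_of_steps hCle h1 le_rfl) h3.le
  have hx : x ≤ 1 := by
    rw [hmk] at h3
    exact h3.le_one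
  have hz1 : (if m = k then 1 else z) ≤ 1 := by
    split_ifs with hm
    · exact le_rfl
    · refine hz.le.trans ?_
      have h5 := hC m (by omega)
      rw [show C (m + 1) = C m from le_antisymm
        (hmk ▸ hj ▸ le_of_steps hCle (by omega) le_rfl) (hCle m (by omega))] at h5
      exact h5.le_one
  refine h2.down ((h4 hz.pos).trans ?_)
  calc v * x * (if m = k then 1 else z) ≤ v * 1 * 1 := by gcongr
    _ = v := by simp

/-- An under-computation decomposes along any sequence of boundaries. -/
theorem Under.pieces {p x y : ℕ} {a : M} (h : Under n w p x y a) {B : ℕ → ℕ} (hB : Monotone B)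
    {i j : ℕ} (hij : i ≤ j) (hi : B i = x) (hj : B j = y) : Pieces n w (3 * p) B i j a := by
  induction h generalizing B i j with
  | nil p x v h => exact (pieces_of_eq hB hij (by omega)).down h
  | leaf p x v h =>
    have hex : ∃ l, i ≤ l ∧ x + 1 ≤ B (l + 1) :=
      ⟨j, hij, hj ▸ hB (Nat.le_succ j)⟩
    classical
    obtain ⟨hl1, hl2⟩ := Nat.find_spec hex
    have hmin := fun l hl => Nat.find_min (m := l) hex hl
    set l := Nat.find hex with hl
    have hl3 : B l ≤ x := by
      rcases hl1.eq_or_lt with h | h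
      · rw [← h, hi]
      · by_contra hcon
        refine hmin (l - 1) (by omega) ⟨by omega, ?_⟩
        rw [show l - 1 + 1 = l by omega]
        omega
    have hlj : l < j := by
      by_contra hcon
      have := hB (not_lt.mp hcon)
      omega
    have h1 := hB hl1
    have h2 := hB hlj
    simp only [Nat.succ_eq_add_one] at h2
    have p1 : Pieces n w (3 * p) B i l 1 := pieces_of_eq hB hl1 (by omega)
    have p2 : Pieces n w (3 * p) B (l + 1) j 1 := pieces_of_eq hB hlj (by omega)
    have p3 : Pieces n w (3 * p) B l (l + 1) v := by
      refine .single ?_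
      rw [show B l = x by omega, show B (l + 1) = x + 1 by omega]
      exact .leaf _ _ _ h
    simpa using (p1.append p3).append p2
  | binary p x y z a b v h1 h2 h ih1 ih2 =>
    have hxy := h1.le
    have hyz := h2.le
    have hz2 : ∃ l, i ≤ l ∧ y ≤ B (l + 1) := ⟨j, hij, by
      have := hB (Nat.le_succ j); simp only [Nat.succ_eq_add_one] at this; omega⟩
    classical
    obtain ⟨hl1, hl2⟩ := Nat.find_spec hz2
    have hmin := fun l hl => Nat.find_min (m := l) hz2 hl
    set l := Nat.find hz2 with hl
    have hl3 : B l ≤ y := by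
      rcases hl1.eq_or_lt with h | h
      · rw [← h, hi]
        exact hxy
      · by_contra hcon
        refine hmin (l - 1) (by omega) ⟨by omega, ?_⟩
        rw [show l - 1 + 1 = l by omega]
        omega
    -- Piece `l` contains the cut `y`: it is made of the last piece of the left child and the first
    -- piece of the right one, joined by a binary node. If `l` is not below `j`, the right child
    -- covers an empty factor.
    by_cases hlj : l < j
    · have q1 := ih1 (B := fun t => min (B t) y) (fun s t hst => min_le_min (hB hst) le_rfl)
        (i := i) (j := l + 1) (by omega) (by omega) (by omega)
      have q2 := ih2 (B := fun t => max (B t) y) (fun s t hst => max_le_max (hB hst) le_rfl)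
        (i := l) (j := j) (by omega) (by omega) (by omega)
      obtain ⟨b0, v2, hb0, hv2, hle2⟩ := q2.uncons hlj
      obtain ⟨v1, a0, q1, ha0, hle1⟩ := q1.unsnoc hl1
      have q1' : Pieces n w (3 * p) B i l v1 := q1.reindex (d := 0) rfl rfl fun t _ ht => by
        have := hB ht
        simp only [add_zero]
        omega
      have q2' : Pieces n w (3 * p) B (l + 1) j v2 := hv2.reindex (d := 0) rfl rfl
        fun t ht _ => by
          have := hB ht
          simp only [add_zero]
          omega
      simp only [min_eq_left hl3, max_eq_right hl3, min_eq_right hl2, max_eq_left hl2]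
        at ha0 hb0
      refine (((q1'.mono (by omega)).append (.single ((ha0.mul hb0).mono (by omega)))).append
        (q2'.mono (by omega))).down ?_
      calc v ≤ a * b := h
        _ ≤ v1 * a0 * (b0 * v2) := mul_le_mul' hle1 hle2
        _ = v1 * (a0 * b0) * v2 := by simp only [mul_assoc]
    · have h3 := hB (not_lt.mp hlj)
      obtain rfl : y = z := by omega
      have q1 := ih1 hB hij hi hj
      exact (q1.mono (by omega)).down (h.trans (mul_le_of_le_one_right' (Under.le_one h2)))
  | idem p k C e v h1 h2 he hc hv ih =>
    exact (IsNodeValue.pieces hB ⟨he, by omega, .inl ⟨rfl, h2⟩⟩ hc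
      (fun t ht B' hB' i j hij h1 h2 => ih t ht hB' hij h1 h2) hij hi hj).down hv
  | stab p k C e v h1 he hc hv ih =>
    exact (IsNodeValue.pieces hB ⟨he, by omega, .inr ⟨rfl, h1⟩⟩ hc
      (fun t ht B' hB' i j hij h1 h2 => ih t ht hB' hij h1 h2) hij hi hj).down hv

theorem Under.split {p x y z : ℕ} {a : M} (h : Under n w p x z a) (hxy : x ≤ y) (hyz : y ≤ z) :
    ∃ b c, Under n w (3 * p) x y b ∧ Under n w (3 * p) y z c ∧ a ≤ b * c := by
  have h1 := h.pieces (B := fun t => if t = 0 then x else if t = 1 then y else z) (i := 0) (j := 2)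
    (monotone_nat_of_le_succ fun t => by rcases t with _ | _ | t <;> simp [*]) (by omega)
    (by simp) (by simp)
  obtain ⟨b, c, hb, h2, hle⟩ := h1.uncons (by omega)
  obtain ⟨c', d, hc, h3, hle'⟩ := h2.uncons (by omega)
  refine ⟨b, c', by simpa using hb, by simpa using hc, ?_⟩
  have hd : d ≤ 1 := by
    cases h3 with
    | nil _ h => exact h
    | snoc _ _ _ _ h => exact absurd h.le (by omega)
  exact hle.trans (mul_le_mul' le_rfl (hle'.trans (mul_le_of_le_one_right' hd)))

end Uniqueness

end StabilisationMonoid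

namespace StabilisationMonoid

section Uniqueness

variable {M : Type*} [StabilisationMonoid M] {n : ℕ} {w : ℕ → M}

/-! ### Comparison of under- and over-computations -/

theorem exists_step_of_mem {C : ℕ → ℕ} {k b : ℕ} (hk : 1 ≤ k) (h0 : C 0 ≤ b) (hb : b ≤ C k) :
    ∃ κ < k, C κ ≤ b ∧ b ≤ C (κ + 1) := by
  induction k, hk using Nat.le_induction with
  | base => exact ⟨0, by omega, h0, hb⟩
  | succ k hk ih =>
    by_cases h : b ≤ C k
    · obtain ⟨κ, h1, h2⟩ := ih h
      exact ⟨κ, by omega, h2⟩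
    · exact ⟨k, by omega, by omega, hb⟩

/-- Moving the boundaries around a factor of value `e♯` outwards, over pieces of value at most
`e`. -/
theorem exists_trim {q i i' j' j s t : ℕ} {B : ℕ → ℕ} {e x y : M} (he : IsIdempotentElem e)
    (hB : Monotone B)
    (hle : ∀ l, i ≤ l → l < j → ∀ b, Under n w (9 * q) (B l) (B (l + 1)) b → b ≤ e)
    (hii : i ≤ i') (hij : i' ≤ j') (hjj : j' ≤ j) (hs : s ≤ B i) (ht : B j ≤ t)
    (hx : Under n w q s (B i') x) (hy : Under n w q (B j') t y) :
    ∃ x₀ y₀, Under n w (9 * q) s (B i) x₀ ∧ Under n w (9 * q) (B j) t y₀ ∧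
      x * sharp e * y ≤ x₀ * sharp e * y₀ := by
  obtain ⟨x₀, c, hx₀, hc, hxc⟩ := hx.split hs (hB hii)
  obtain ⟨d, y₀, hd, hy₀, hdy⟩ := hy.split (hB hjj) ht
  -- The part `c` removed from `x` covers whole pieces, so it is at most `e`, or at most `1` if
  -- there are none. In both cases `e♯` absorbs it.
  have hc1 : c * sharp e ≤ sharp e := by
    rcases ((hc.pieces hB hii rfl rfl).mono (show 3 * (3 * q) ≤ 9 * q by omega)).le_idem he
      (fun l h1 h2 => hle l h1 (by omega)) with h | ⟨_, h⟩
    · exact (mul_le_mul' h le_rfl).trans (mul_sharp he).le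
    · exact mul_le_of_le_one_left' h
  have hd1 : sharp e * d ≤ sharp e := by
    rcases ((hd.pieces hB hjj rfl rfl).mono (show 3 * (3 * q) ≤ 9 * q by omega)).le_idem he
      (fun l h1 h2 => hle l (by omega) h2) with h | ⟨_, h⟩
    · exact (mul_le_mul' le_rfl h).trans (sharp_mul he).le
    · exact mul_le_of_le_one_right' h
  refine ⟨x₀, y₀, hx₀.mono (by omega), hy₀.mono (by omega), ?_⟩
  calc x * sharp e * y ≤ x₀ * c * sharp e * (d * y₀) := by gcongr
    _ = x₀ * (c * sharp e) * d * y₀ := by simp only [mul_assoc]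
    _ ≤ x₀ * sharp e * d * y₀ := by gcongr
    _ = x₀ * (sharp e * d) * y₀ := by simp only [mul_assoc]
    _ ≤ x₀ * sharp e * y₀ := by gcongr

/-- The value `z` is idempotent, so the children before a chosen one can be split off as a factor
above `z` without losing `z`. -/
theorem IsNodeValue.exists_prefix {k p : ℕ} {f z : M} (h : IsNodeValue n k f z) {C : ℕ → ℕ}
    (hC : ∀ i < k, Under n w p (C i) (C (i + 1)) f) {κ : ℕ} (hκ : κ ≤ k) :
    ∃ c, Under n w (p + 1) (C 0) (C κ) c ∧ z ≤ c * z := by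
  rcases Nat.eq_zero_or_pos κ with rfl | hpos
  · exact ⟨1, under_one, by simp⟩
  · obtain ⟨c, hc, hc'⟩ := h.exists_block hC hpos hκ
    exact ⟨c, hc', by conv_lhs => rw [← h.mul_self]
                      gcongr⟩

theorem IsNodeValue.exists_suffix {k p : ℕ} {f z : M} (h : IsNodeValue n k f z) {C : ℕ → ℕ}
    (hC : ∀ i < k, Under n w p (C i) (C (i + 1)) f) {κ : ℕ} (hκ : κ ≤ k) :
    ∃ c, Under n w (p + 1) (C κ) (C k) c ∧ z ≤ z * c := by
  rcases hκ.eq_or_lt with rfl | hlt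
  · exact ⟨1, under_one, by simp⟩
  · obtain ⟨c, hc, hc'⟩ := h.exists_block hC hlt le_rfl
    exact ⟨c, hc', by conv_lhs => rw [← h.mul_self]
                      gcongr⟩

/-- An under-computation of bounded height over many consecutive non-empty pieces, all of whose
values are at most `e`, has to use stabilisation: `e♯` occurs in its value. -/
theorem exists_sharp_bound (M : Type*) [StabilisationMonoid M] (n p : ℕ) :
    ∃ Q N : ℕ, ∀ (w : ℕ → M) (e : M), IsIdempotentElem e → ∀ B : ℕ → ℕ, Monotone B →
      ∀ (i k s t : ℕ) (a : M), N ≤ k → (∀ j, i ≤ j → j < i + k → B j < B (j + 1)) →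
      (∀ j, i ≤ j → j < i + k → ∀ b, Under n w Q (B j) (B (j + 1)) b → b ≤ e) →
      Under n w p s t a → s ≤ B i → B (i + k) ≤ t →
      ∃ x y, Under n w Q s (B i) x ∧ Under n w Q (B (i + k)) t y ∧ a ≤ x * sharp e * y := by
  have hfin : Finite M := StabilisationMonoid.finite
  have : Fintype M := Fintype.ofFinite M
  have hshort : ∀ (B : ℕ → ℕ), Monotone B → ∀ i k s t : ℕ, 2 ≤ k →
      (∀ j, i ≤ j → j < i + k → B j < B (j + 1)) → s ≤ B i → B (i + k) ≤ t → t ≤ s + 1 → False := by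
    intro B hB i k s t hk hlt hs ht hst
    have h1 := hlt i le_rfl (by omega)
    have h2 := hlt (i + 1) (by omega) (by omega)
    have h3 := hB (show i + 1 + 1 ≤ i + k by omega)
    omega
  induction p with
  | zero =>
    refine ⟨0, 2, fun w e he B hB i k s t a hk hlt _ h hs ht => ?_⟩
    exfalso
    refine hshort B hB i k s t hk hlt hs ht ?_
    cases h <;> omega
  | succ p ih =>
    obtain ⟨Q₀, N₀, ih⟩ := ih
    -- Enough coarse cuts for a repeated pair among the even ones, and for a node with more than `n`
    -- children. The factor `9` below is the cost of `exists_trim`, which splits and then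
    -- decomposes, each at triple height.
    set T := 2 * Fintype.card (M × M) + n + 2 with hT
    set q := Q₀ + 9 * p + 9 with hq
    refine ⟨9 * q, T * (N₀ + 1) + 2, fun w e he B hB i k s t a hk hlt hle h hs ht => ?_⟩
    have hN₀ : 2 * N₀ ≤ k := by nlinarith
    have finish : ∀ i' j' x y, i ≤ i' → i' ≤ j' → j' ≤ i + k → Under n w q s (B i') x →
        Under n w q (B j') t y → a ≤ x * sharp e * y →
        ∃ x y, Under n w (9 * q) s (B i) x ∧ Under n w (9 * q) (B (i + k)) t y ∧
          a ≤ x * sharp e * y := by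
      intro i' j' x y h1 h2 h3 hx hy hle'
      obtain ⟨x₀, y₀, h4, h5, h6⟩ := exists_trim he hB hle h1 h2 h3 hs ht hx hy
      exact ⟨x₀, y₀, h4, h5, hle'.trans h6⟩
    have inner : ∀ (i' k' s' t' : ℕ) (b : M), N₀ ≤ k' → i ≤ i' → i' + k' ≤ i + k →
        Under n w p s' t' b → s' ≤ B i' → B (i' + k') ≤ t' → ∃ x y, Under n w Q₀ s' (B i') x ∧
          Under n w Q₀ (B (i' + k')) t' y ∧ b ≤ x * sharp e * y := by
      intro i' k' s' t' b h1 h2 h3 h4 h5 h6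
      exact ih w e he B hB i' k' s' t' b h1 (fun j h7 h8 => hlt j (by omega) (by omega))
        (fun j h7 h8 b hb => hle j (by omega) (by omega) b (hb.mono (by omega))) h4 h5 h6
    rcases h.cases_succ with hst | ⟨c, a₁, a₂, h₁, h₂, ha⟩ | ⟨K, C, f, z, hz, rfl, rfl, hC, ha⟩
    · exact (hshort B hB i k s t (by omega) hlt hs ht hst).elim
    · rcases le_total (B (i + N₀)) c with hc | hc
      · obtain ⟨x, y, hx, hy, hxy⟩ := inner i N₀ s c a₁ le_rfl le_rfl (by omega) h₁ hs hc
        refine finish i (i + N₀) x (y * a₂) le_rfl (by omega) (by omega) (hx.mono (by omega))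
          (((hy.mono (show Q₀ ≤ Q₀ + p by omega)).mul (h₂.mono (by omega))).mono (by omega)) ?_
        rw [← mul_assoc]
        exact ha.trans (mul_le_mul' hxy le_rfl)
      · obtain ⟨x, y, hx, hy, hxy⟩ := inner (i + N₀) N₀ c t a₂ le_rfl (by omega) (by omega) h₂ hc
          ((hB (by omega)).trans ht)
        refine finish (i + N₀) (i + N₀ + N₀) (a₁ * x) y (by omega) (by omega) (by omega)
          (((h₁.mono (show p ≤ Q₀ + p by omega)).mul (hx.mono (by omega))).mono (by omega))
          (hy.mono (by omega)) ?_
        rw [mul_assoc a₁, mul_assoc a₁]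
        exact ha.trans (mul_le_mul' le_rfl hxy)
    · have hCle : ∀ r < K, C r ≤ C (r + 1) := fun r hr => (hC r hr).le
      have hzz : ∀ {c₁ c₂ b : M}, z ≤ c₁ * z → z ≤ z * c₂ → z ≤ b → z ≤ c₁ * b * c₂ := by
        intro c₁ c₂ b h1 h2 h3
        calc z ≤ c₁ * z := h1
          _ ≤ c₁ * (z * c₂) := by gcongr
          _ ≤ c₁ * (b * c₂) := by gcongr
          _ = c₁ * b * c₂ := by rw [mul_assoc]
      -- Coarse boundaries, more than `N₀` pieces apart.
      set D : ℕ → ℕ := fun r => i + r * (N₀ + 1) with hD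
      have hDT : ∀ r ≤ T, D r ≤ i + k := fun r hr => by
        have := Nat.mul_le_mul_right (N₀ + 1) hr
        simp only [hD]
        omega
      have hDlt : ∀ r r', r < r' → D r + N₀ + 1 ≤ D r' := fun r r' hr => by
        have := Nat.mul_le_mul_right (N₀ + 1) (Nat.succ_le_of_lt hr)
        rw [Nat.succ_mul] at this
        simp only [hD]
        omega
      have hiD : ∀ r, i ≤ D r := fun r => by simp only [hD]; omega
      have hBD : ∀ r r', r < r' → r' ≤ T → B (D r) < B (D r') := fun r r' hr hr' => by
        have h1 := hDlt r r' hr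
        have h2 := hDT r' hr'
        exact (hlt (D r) (hiD r) (by omega)).trans_le (hB (by omega))
      -- If one child covers a coarse gap, the induction hypothesis applies inside it. Otherwise
      -- distinct coarse boundaries lie in distinct children, so there are more than `n` of them and
      -- the node stabilises.
      by_cases hchild : ∃ κ < K, ∃ r r', r < r' ∧ r' ≤ T ∧ C κ ≤ B (D r) ∧ B (D r') ≤ C (κ + 1)
      · obtain ⟨κ, hκ, r, r', hr, hr', h1, h2⟩ := hchild
        have h3 := hDlt r r' hr
        obtain ⟨d, hd⟩ : ∃ d, D r' = D r + d := ⟨D r' - D r, by omega⟩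
        have h4 := hDT r' hr'
        obtain ⟨x, y, hx, hy, hxy⟩ := inner (D r) d (C κ) (C (κ + 1)) f (by omega) (hiD r)
          (by omega) (hC κ hκ) h1 (hd ▸ h2)
        obtain ⟨c₁, hc₁, hzc₁⟩ := hz.exists_prefix hC hκ.le
        obtain ⟨c₂, hc₂, hzc₂⟩ := hz.exists_suffix hC (show κ + 1 ≤ K from hκ)
        refine finish (D r) (D r + d) (c₁ * x) (y * c₂) (hiD r) (by omega) (by omega)
          (((hc₁.mono (show p + 1 ≤ Q₀ + p + 1 by omega)).mul (hx.mono (by omega))).mono (by omega))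
          (((hy.mono (show Q₀ ≤ Q₀ + p + 1 by omega)).mul (hc₂.mono (by omega))).mono (by omega)) ?_
        calc a ≤ z := ha
          _ ≤ c₁ * (x * sharp e * y) * c₂ := hzz hzc₁ hzc₂ (hz.le.trans hxy)
          _ = c₁ * x * sharp e * (y * c₂) := by simp only [mul_assoc]
      · push Not at hchild
        have hex : ∀ r, ∃ κ, r ≤ T → κ < K ∧ C κ ≤ B (D r) ∧ B (D r) ≤ C (κ + 1) := by
          intro r
          by_cases hr : r ≤ T
          · obtain ⟨κ, h1, h2, h3⟩ := exists_step_of_mem (C := C) hz.pos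
              (hs.trans (hB (hiD r))) ((hB (hDT r hr)).trans ht)
            exact ⟨κ, fun _ => ⟨h1, h2, h3⟩⟩
          · exact ⟨0, fun h => absurd h hr⟩
        choose ι hι using hex
        have hιlt : ∀ r r', r < r' → r' ≤ T → ι r < ι r' := by
          intro r r' hr hr'
          obtain ⟨h1, h2, h3⟩ := hι r (by omega)
          obtain ⟨h4, h5, h6⟩ := hι r' hr'
          by_contra hcon
          have h7 := hchild (ι r') h4 r r' hr hr'
          have h8 : C (ι r') ≤ C (ι r) := le_of_steps hCle (not_lt.mp hcon) (by omega)
          rcases (not_lt.mp hcon).eq_or_lt with h9 | h9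
          · rw [h9] at h6 h7
            exact absurd h6 (not_le.mpr (h7 h2))
          · have h10 : C (ι r' + 1) ≤ C (ι r) := le_of_steps hCle h9 (by omega)
            have := hBD r r' hr hr'
            omega
        have hιge : ∀ r ≤ T, r ≤ ι r := by
          intro r hr
          induction r with
          | zero => omega
          | succ r ih =>
            have h1 := hιlt r (r + 1) (by omega) hr
            have h2 := ih (by omega)
            omega
        have hKn : n < K := by
          have h1 := hιge T le_rfl
          have h2 := (hι T le_rfl).1
          omega
        have hzf : z = sharp f := by
          rcases hz.eq with ⟨_, h1⟩ | ⟨h1, _⟩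
          · omega
          · exact h1
        have hcut : ∀ r, ∃ lr : M × M, r ≤ T → Under n w (3 * p) (C (ι r)) (B (D r)) lr.1 ∧
            Under n w (3 * p) (B (D r)) (C (ι r + 1)) lr.2 ∧ f ≤ lr.1 * lr.2 := by
          intro r
          by_cases hr : r ≤ T
          · obtain ⟨h1, h2, h3⟩ := hι r hr
            obtain ⟨b, c, h4, h5, h6⟩ := (hC _ h1).split h2 h3
            exact ⟨(b, c), fun _ => ⟨h4, h5, h6⟩⟩
          · exact ⟨1, fun h => absurd h hr⟩
        choose lr hlr using hcut
        -- Two cut children are split into the same pair of values. Only even indices are used, so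
        -- that a complete child lies between the two and the middle block is not empty.
        obtain ⟨r, r', hr, heq⟩ : ∃ r r' : ℕ, r < r' ∧ r' ≤ Fintype.card (M × M) ∧
            lr (2 * r) = lr (2 * r') := by
          obtain ⟨x, y, hxy, h⟩ := Fintype.exists_ne_map_eq_of_card_lt
            (fun r : Fin (Fintype.card (M × M) + 1) => lr (2 * r)) (by simp)
          rcases lt_or_gt_of_ne hxy with h' | h'
          · exact ⟨x, y, h', Nat.lt_succ_iff.mp y.2, h⟩
          · exact ⟨y, x, h', Nat.lt_succ_iff.mp x.2, h.symm⟩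
        obtain ⟨hr', heq⟩ := heq
        obtain ⟨l1, l2, l3⟩ := hlr (2 * r) (by omega)
        obtain ⟨l4, l5, l6⟩ := hlr (2 * r') (by omega)
        rw [← heq] at l4 l5
        set l := (lr (2 * r)).1 with hl
        set ρ := (lr (2 * r)).2 with hρ
        have h1 := hιlt (2 * r) (2 * r + 1) (by omega) (by omega)
        have h2 := hιlt (2 * r + 1) (2 * r') (by omega) (by omega)
        have h3 := (hι (2 * r') (by omega)).1
        obtain ⟨c, hc, hc'⟩ := hz.exists_block hC (show ι (2 * r) + 1 < ι (2 * r') by omega)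
          (by omega)
        have hdr := hDlt (2 * r) (2 * r') (by omega)
        have hdr' := hDT (2 * r') (by omega)
        -- The value `ρ c l` is that of an under-computation over the pieces between the two cuts,
        -- hence at most `e`. Since `f♯ ≤ c` and `f ≤ l ρ`, this is the hypothesis of
        -- `sharp_le_mul_sharp_mul`.
        have hmid : ρ * c * l ≤ e := by
          have h4 : Under n w (3 * p + 3) (B (D (2 * r))) (B (D (2 * r'))) (ρ * c * l) :=
            ((l2.mono (show 3 * p ≤ 3 * p + 1 by omega)).mul (hc'.mono (by omega))).mul
              (l4.mono (by omega))
          rcases (h4.pieces hB (show D (2 * r) ≤ D (2 * r') by omega) rfl rfl).le_idem he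
            (fun j h5 h6 b hb => hle j ((hiD _).trans h5) (by omega) b
              (hb.mono (by omega))) with h7 | ⟨h7, _⟩
          · exact h7
          · omega
        have hkey : z ≤ l * sharp e * ρ := by
          rw [hzf]
          refine sharp_le_mul_sharp_mul he hz.idem l3 (le_trans ?_ hmid)
          rw [← hzf]
          gcongr
        obtain ⟨c₁, hc₁, hzc₁⟩ := hz.exists_prefix hC (hι (2 * r) (by omega)).1.le
        obtain ⟨c₂, hc₂, hzc₂⟩ := hz.exists_suffix hC (show ι (2 * r') + 1 ≤ K from h3)
        refine finish (D (2 * r)) (D (2 * r')) (c₁ * l) (ρ * c₂) (hiD _) (by omega) (by omega)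
          (((hc₁.mono (show p + 1 ≤ 3 * p + 1 by omega)).mul (l1.mono (by omega))).mono (by omega))
          (((l5.mono (show 3 * p ≤ 3 * p + 1 by omega)).mul (hc₂.mono (by omega))).mono (by omega)) ?_
        calc a ≤ z := ha
          _ ≤ c₁ * (l * sharp e * ρ) * c₂ := hzz hzc₁ hzc₂ hkey
          _ = c₁ * l * sharp e * (ρ * c₂) := by simp only [mul_assoc]

theorem le_of_steps_le {q k : ℕ} {C : ℕ → ℕ} {e a : M} (he : IsIdempotentElem e)
    (hk : 1 ≤ k) (hC : ∀ i < k, C i ≤ C (i + 1))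
    (hle : ∀ i < k, ∀ b, Under n w (3 * q) (C i) (C (i + 1)) b → b ≤ e)
    (h : Under n w q (C 0) (C k) a) : a ≤ e := by
  -- Boundaries are frozen after index `k`, as decompositions require a sequence monotone
  -- everywhere.
  have hmono : Monotone fun i => C (min i k) := fun i j hij =>
    le_of_steps hC (min_le_min hij le_rfl) (min_le_right _ _)
  rcases (h.pieces hmono (Nat.zero_le k) (by simp) (by simp)).le_idem he (fun t _ ht b hb => by
    simp only [min_eq_left ht.le, min_eq_left (show t + 1 ≤ k from ht)] at hb
    exact hle t ht b hb) with h | ⟨h, _⟩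
  · exact h
  · omega

/-- Values of under-computations are below values of over-computations of the same word, as soon
as the threshold of the latter is large with respect to the threshold of the former. -/
theorem exists_threshold (M : Type*) [StabilisationMonoid M] (n p q : ℕ) :
    ∃ N₀, ∀ N ≥ N₀, ∀ (w : ℕ → M) (x y : ℕ) (a b : M), Under n w q x y a →
      Seg (· ≥ ·) N w p x y b → a ≤ b := by
  induction p generalizing q with
  | zero =>
    refine ⟨0, fun N _ w x y a b ha hb => ?_⟩
    cases hb with
    | nil _ _ _ h => exact ha.le_one.trans h
    | leaf _ _ _ h => exact (by simpa using ha.le_iprod : a ≤ w x).trans h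
  | succ p ih =>
    -- The four constants serve respectively for the number of pieces that forces `e♯`, for the
    -- children cut at height `3q`, for those examined at height `Q`, and for children over the
    -- empty factor.
    obtain ⟨Q, N₁, hQ⟩ := exists_sharp_bound M n q
    obtain ⟨N₂, h₂⟩ := ih (3 * q)
    obtain ⟨N₃, h₃⟩ := ih Q
    obtain ⟨N₄, h₄⟩ := ih 0
    refine ⟨N₁ + N₂ + N₃ + N₄, fun N hN w x y a b ha hb => ?_⟩
    cases hb with
    | nil _ _ _ h => exact ha.le_one.trans h
    | leaf _ _ _ h => exact (by simpa using ha.le_iprod : a ≤ w x).trans h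
    | binary p x c y b₁ b₂ b h1 h2 h =>
      obtain ⟨a₁, a₂, ha₁, ha₂, hle⟩ := ha.split h1.le h2.le
      exact (hle.trans (mul_le_mul' (h₂ N (by omega) w _ _ _ _ ha₁ h1)
        (h₂ N (by omega) w _ _ _ _ ha₂ h2))).trans h
    | idem p k C e b hk hkN he hC h =>
      exact (le_of_steps_le he (by omega) (fun i hi => (hC i hi).le)
        (fun i hi c hc => h₂ N (by omega) w _ _ _ _ hc (hC i hi)) ha).trans h
    | stab p k C e b hk he hC h =>
      refine le_trans ?_ h
      have hCle : ∀ i < k, C i ≤ C (i + 1) := fun i hi => (hC i hi).le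
      have hae : a ≤ e := le_of_steps_le he (by omega) hCle
        (fun i hi c hc => h₂ N (by omega) w _ _ _ _ hc (hC i hi)) ha
      -- A child over an empty factor gives `1 ≤ e`, so `1 = 1♯ ≤ e♯` and `e ≤ e e♯ = e♯`. Without
      -- such a child the pieces are non-empty and `exists_sharp_bound` applies, the outer factors
      -- being over empty intervals.
      by_cases hemp : ∃ i < k, C (i + 1) ≤ C i
      · obtain ⟨i, hi, hCi⟩ := hemp
        have h1e : (1 : M) ≤ e := by
          refine h₄ N (by omega) w (C i) (C (i + 1)) 1 e ?_ (hC i hi)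
          rw [le_antisymm hCi (hCle i hi)]
          exact under_one
        have h1s : (1 : M) ≤ sharp e := by
          have := sharp_mono 1 e IsIdempotentElem.one he h1e
          rwa [sharp_one] at this
        calc a ≤ e := hae
          _ = e * 1 := (mul_one e).symm
          _ ≤ e * sharp e := by gcongr
          _ = sharp e := mul_sharp he
      · push Not at hemp
        have hmono : Monotone fun i => C (min i k) := fun i j hij =>
          le_of_steps hCle (min_le_min hij le_rfl) (min_le_right _ _)
        have hmin : ∀ j < k, min j k = j ∧ min (j + 1) k = j + 1 := fun j hj => by omega
        obtain ⟨c, d, hc, hd, hle⟩ := hQ w e he _ hmono 0 k (C 0) (C k) a (by omega)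
          (fun j _ hj => by
            simp only [zero_add] at hj
            simp only [(hmin j hj).1, (hmin j hj).2]
            exact hemp j hj)
          (fun j _ hj b hb => by
            simp only [zero_add] at hj
            simp only [(hmin j hj).1, (hmin j hj).2] at hb
            exact h₃ N (by omega) w _ _ _ _ hb (hC j hj)) ha (by simp) (by simp)
        simp only [zero_add, min_self, Nat.zero_min] at hc hd
        calc a ≤ c * sharp e * d := hle
          _ ≤ 1 * sharp e * 1 := by gcongr; exacts [hc.le_one, hd.le_one]
          _ = sharp e := by simp

end Uniqueness

end StabilisationMonoid

namespace StabilisationMonoid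

/-! ### Factorisation forests: every word has a computation of bounded height. -/

section Existence

variable {M : Type*} [StabilisationMonoid M] {n : ℕ}

/-! ### Layers of a stabilisation monoid -/

/-- A two-sided ideal of the monoid (not to be confused with the lower sets of the order). -/
structure IsTwoSided (K : Set M) : Prop where
  mul_left : ∀ (a : M) {x : M}, x ∈ K → a * x ∈ K
  mul_right : ∀ {x : M} (a : M), x ∈ K → x * a ∈ K

/-- `J` is a maximal class of the two-sided ideal `K` for mutual divisibility. -/
structure IsLayer (K J : Set M) : Prop where
  ideal : IsTwoSided K
  rest : IsTwoSided (K \ J)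
  subset : J ⊆ K
  nonempty : J.Nonempty
  connected : ∀ {x y : M}, x ∈ J → y ∈ J → ∃ a b, a * x * b = y

theorem IsTwoSided.exists_layer {K : Set M} (hK : IsTwoSided K) (hne : K.Nonempty) :
    ∃ J, IsLayer K J := by
  have : Finite M := StabilisationMonoid.finite
  obtain ⟨j, hj, hmax⟩ := K.toFinite.exists_maximalFor
    (fun x => {z | ∃ a b, a * x * b = z}) K hne
  have hmul : ∀ a b x c d : M, a * (c * x * d) * b = a * c * x * (d * b) := by
    intros
    simp only [mul_assoc]
  have key : ∀ x ∈ K, (∃ a b, a * x * b = j) → ∃ a b, a * j * b = x := by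
    rintro x hx ⟨a, b, rfl⟩
    have := hmax hx (by
      rintro z ⟨c, d, rfl⟩
      exact ⟨c * a, b * d, (hmul c d x a b).symm⟩)
    exact this ⟨1, 1, by simp⟩
  refine ⟨{x ∈ K | ∃ a b, a * x * b = j}, hK, ⟨?_, ?_⟩, fun x hx => hx.1,
    ⟨j, hj, 1, 1, by simp⟩, ?_⟩
  · rintro a x ⟨hx, hx'⟩
    refine ⟨hK.mul_left a hx, fun ⟨_, c, d, h⟩ => hx' ⟨hx, c * a, d, ?_⟩⟩
    rw [← h, ← mul_assoc]
  · rintro x a ⟨hx, hx'⟩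
    refine ⟨hK.mul_right a hx, fun ⟨_, c, d, h⟩ => hx' ⟨hx, c, a * d, ?_⟩⟩
    rw [← h]
    simp only [mul_assoc]
  · rintro x y ⟨hx, a, b, rfl⟩ ⟨hy, h⟩
    obtain ⟨c, d, rfl⟩ := key y hy h
    exact ⟨c * a, b * d, (hmul c d x a b).symm⟩

namespace IsLayer

variable {K J : Set M}

theorem mem_of_mul_mem (h : IsLayer K J) {x a b : M} (hx : x ∈ K) (hab : a * x * b ∈ J) :
    x ∈ J := by
  by_contra hcon
  exact (h.rest.mul_right b (h.rest.mul_left a ⟨hx, hcon⟩)).2 hab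

theorem mem_of_mul_mem_left (h : IsLayer K J) {x b : M} (hx : x ∈ K) (hb : x * b ∈ J) : x ∈ J :=
  h.mem_of_mul_mem (a := 1) hx (by simpa using hb)

theorem mem_of_mul_mem_right (h : IsLayer K J) {x a : M} (hx : x ∈ K) (ha : a * x ∈ J) : x ∈ J :=
  h.mem_of_mul_mem (b := 1) hx (by simpa using ha)

theorem eq_pow_mul_pow {x a b : M} (h : a * x * b = x) (k : ℕ) : a ^ k * x * b ^ k = x := by
  induction k with
  | zero => simp
  | succ k ih =>
    calc a ^ (k + 1) * x * b ^ (k + 1) = a ^ k * (a * x * b) * b ^ k := by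
          rw [pow_succ, pow_succ']; simp only [mul_assoc]
      _ = x := by rw [h, ih]

/-- Stability of finite monoids: `a x (m b) = x` can be iterated, and at an idempotent exponent the
power of `m b` alone fixes `x`. -/
theorem exists_mul_right (h : IsLayer K J) {x m : M} (hx : x ∈ J) (hm : x * m ∈ J) :
    ∃ m', x * m * m' = x := by
  have : Finite M := StabilisationMonoid.finite
  obtain ⟨a, b, hab⟩ := h.connected hm hx
  obtain ⟨ω, hω⟩ : ∃ ω, (Nat.card M).factorial = ω + 1 :=
    ⟨_, (Nat.succ_pred_eq_of_pos (Nat.factorial_pos _)).symm⟩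
  have hi := isIdempotentElem_pow_factorial (m * b)
  rw [hω] at hi
  have h1 := eq_pow_mul_pow (x := x) (a := a) (b := m * b)
    (by simp only [mul_assoc] at hab ⊢; exact hab) (ω + 1)
  refine ⟨b * (m * b) ^ ω, ?_⟩
  calc x * m * (b * (m * b) ^ ω) = x * (m * b) ^ (ω + 1) := by
        rw [pow_succ']; simp only [mul_assoc]
    _ = a ^ (ω + 1) * x * (m * b) ^ (ω + 1) * (m * b) ^ (ω + 1) := by rw [h1]
    _ = x := by rw [mul_assoc _ ((m * b) ^ (ω + 1)), hi.eq, h1]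

theorem exists_mul_left (h : IsLayer K J) {x m : M} (hx : x ∈ J) (hm : m * x ∈ J) :
    ∃ m', m' * (m * x) = x := by
  have : Finite M := StabilisationMonoid.finite
  obtain ⟨a, b, hab⟩ := h.connected hm hx
  obtain ⟨ω, hω⟩ : ∃ ω, (Nat.card M).factorial = ω + 1 :=
    ⟨_, (Nat.succ_pred_eq_of_pos (Nat.factorial_pos _)).symm⟩
  have hi := isIdempotentElem_pow_factorial (a * m)
  rw [hω] at hi
  have h1 := eq_pow_mul_pow (x := x) (a := a * m) (b := b)
    (by simp only [mul_assoc] at hab ⊢; exact hab) (ω + 1)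
  refine ⟨(a * m) ^ ω * a, ?_⟩
  calc (a * m) ^ ω * a * (m * x) = (a * m) ^ (ω + 1) * x := by
        rw [pow_succ]; simp only [mul_assoc]
    _ = (a * m) ^ (ω + 1) * ((a * m) ^ (ω + 1) * x * b ^ (ω + 1)) := by rw [h1]
    _ = x := by
      rw [← mul_assoc, ← mul_assoc, hi.eq, h1]

/-- If `e♯ = e e♯` stays in the class `J`, then `e` is a right multiple of `e♯`, so `e♯ e = e`,
while `e♯ e = e♯` in any case. Hence stabilisation either does nothing or falls strictly. -/
theorem sharp_eq_or_mem (h : IsLayer K J) {e : M} (he : e ∈ J) (hi : IsIdempotentElem e) :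
    sharp e = e ∨ sharp e ∈ K \ J := by
  have hK : sharp e ∈ K := by
    rw [← mul_sharp hi]
    exact h.ideal.mul_right _ (h.subset he)
  by_cases hJ : sharp e ∈ J
  · left
    obtain ⟨m, hm⟩ := h.exists_mul_right he (by rwa [mul_sharp hi] : e * sharp e ∈ J)
    rw [mul_sharp hi] at hm
    calc sharp e = sharp e * e := (sharp_mul hi).symm
      _ = sharp e * (sharp e * m) := by rw [hm]
      _ = e := by rw [← mul_assoc, (sharp_idempotent e hi).eq, hm]
  · exact .inr ⟨hK, hJ⟩

/-- The right class of the first of two letters with product in `J` contains an idempotent. -/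
theorem exists_idem (h : IsLayer K J) {x y : M} (hx : x ∈ K) (hy : y ∈ K) (hxy : x * y ∈ J) :
    ∃ f c, IsIdempotentElem f ∧ f ∈ J ∧ f * x = x ∧ x * c = f := by
  have : Finite M := StabilisationMonoid.finite
  have hxJ := h.mem_of_mul_mem_left hx hxy
  obtain ⟨m, hm⟩ := h.exists_mul_right hxJ hxy
  set g := (y * m) ^ (Nat.card M).factorial with hg
  have hxg : x * g = x := by
    have : ∀ k, x * (y * m) ^ k = x := by
      intro k
      induction k with
      | zero => simp
      | succ k ih => rw [pow_succ, ← mul_assoc, ih, ← mul_assoc, hm]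
    exact this _
  have hgK : g ∈ K := by
    obtain ⟨ω, hω⟩ : ∃ ω, (Nat.card M).factorial = ω + 1 :=
      ⟨_, (Nat.succ_pred_eq_of_pos (Nat.factorial_pos _)).symm⟩
    rw [hg, hω, pow_succ]
    exact h.ideal.mul_left _ (h.ideal.mul_right _ hy)
  have hgJ : g ∈ J := h.mem_of_mul_mem_right hgK (hxg.symm ▸ hxJ)
  obtain ⟨c, hc⟩ := h.exists_mul_left hgJ (hxg.symm ▸ hxJ)
  rw [hxg] at hc
  have hfx : x * c * x = x := by rw [mul_assoc, hc, hxg]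
  refine ⟨x * c, c, ?_, ?_, hfx, rfl⟩
  · rw [IsIdempotentElem, ← mul_assoc, hfx]
  · exact h.mem_of_mul_mem_left (h.ideal.mul_right _ hx) (hfx.symm ▸ hxJ)

theorem iprod_mem (h : IsLayer K J) {b : ℕ → M} {c k : ℕ} (hb : ∀ x, c ≤ x → x < k → b x ∈ K)
    (hJ : iprod b c k ∈ J) {x y : ℕ} (hx : c ≤ x) (hxy : x < y) (hy : y ≤ k) :
    iprod b x y ∈ J := by
  have hK : iprod b x y ∈ K := by
    rw [← iprod_mul b (Nat.le_succ x) hxy, Nat.succ_eq_add_one, iprod_succ]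
    exact h.ideal.mul_right _ (hb x hx (by omega))
  refine h.mem_of_mul_mem (a := iprod b c x) (b := iprod b y k) hK ?_
  rwa [iprod_mul b hx hxy.le, iprod_mul b (by omega) hy]

/-- A colouring of the positions of a word all of whose factors have their product in `J`: the
factors between positions of the same colour have the same idempotent product. -/
theorem exists_colouring (h : IsLayer K J) {b : ℕ → M} {c k : ℕ} (hck : c + 1 < k)
    (hb : ∀ x, c ≤ x → x < k → b x ∈ K) (hJ : iprod b c k ∈ J) :
    ∃ s : ℕ → M, (∀ x, c ≤ x → x < k → s x ∈ J) ∧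
      ∀ x y x' y', c ≤ x → x < y → y < k → c ≤ x' → x' < y' → y' < k → s x = s y →
        s x' = s x → s y' = s x → IsIdempotentElem (iprod b x y) ∧
          iprod b x' y' = iprod b x y := by
  classical
  have hmem : ∀ {x y}, c ≤ x → x < y → y ≤ k → iprod b x y ∈ J :=
    fun hx hxy hy => h.iprod_mem hb hJ hx hxy hy
  obtain ⟨f, g, hf, hfJ, hfb, hbg⟩ : ∃ f g, IsIdempotentElem f ∧ f ∈ J ∧ f * b c = b c ∧
      b c * g = f := by
    refine h.exists_idem (hb c le_rfl (by omega)) (hb (c + 1) (by omega) (by omega)) ?_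
    have := hmem (x := c) (y := c + 2) le_rfl (by omega) (by omega)
    rwa [← iprod_mul b (Nat.le_succ c) (Nat.le_succ (c + 1)), Nat.succ_eq_add_one, iprod_succ,
      Nat.succ_eq_add_one, iprod_succ] at this
  -- The factor `f` changes no non-empty prefix product, and it puts the empty prefix in `J` too.
  set P : ℕ → M := fun x => f * iprod b c x with hP
  have hfP : ∀ x, f * P x = P x := fun x => by simp only [hP]; rw [← mul_assoc, hf.eq]
  have hPJ : ∀ x, c ≤ x → x ≤ k → P x ∈ J := by
    intro x hx hxk
    rcases hx.eq_or_lt with rfl | hlt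
    · simpa [hP] using hfJ
    · have : P x = iprod b c x := by
        simp only [hP]
        rw [← iprod_mul b (Nat.le_succ c) hlt, Nat.succ_eq_add_one, iprod_succ, ← mul_assoc, hfb]
      rw [this]
      exact hmem le_rfl hlt hxk
  have hPmul : ∀ {x y}, c ≤ x → x ≤ y → P x * iprod b x y = P y := fun hx hxy => by
    simp only [hP]
    rw [mul_assoc, iprod_mul b hx hxy]
  -- In each right class of `J` a representative `r` is chosen in the left class of `f`: then `r' r
  -- = f`, and multiplication by `r` loses no information on elements fixed by `f`.
  have hrep : ∀ y ∈ J, ∃ r r', r ∈ J ∧ r * f = r ∧ r' * r = f ∧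
      Set.range (r * ·) = Set.range (y * ·) := by
    intro y hy
    obtain ⟨α, β, rfl⟩ := h.connected hfJ hy
    have hrJ : α * f ∈ J := h.mem_of_mul_mem_left (h.ideal.mul_left _ (h.subset hfJ)) hy
    obtain ⟨β', hβ⟩ := h.exists_mul_right hrJ hy
    obtain ⟨r', hr'⟩ := h.exists_mul_left hfJ hrJ
    refine ⟨α * f, r', hrJ, by rw [mul_assoc, hf.eq], hr', ?_⟩
    apply Set.Subset.antisymm
    · rintro _ ⟨m, rfl⟩
      refine ⟨β' * m, ?_⟩
      simp only
      rw [← mul_assoc, hβ]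
    · rintro _ ⟨m, rfl⟩
      exact ⟨β * m, by simp only [mul_assoc]⟩
  have hrep' : ∀ S : Set M, ∃ r, (∃ y ∈ J, Set.range (y * ·) = S) →
      ∃ r', r ∈ J ∧ r * f = r ∧ r' * r = f ∧ Set.range (r * ·) = S := by
    intro S
    by_cases hS : ∃ y ∈ J, Set.range (y * ·) = S
    · obtain ⟨y, hy, rfl⟩ := hS
      obtain ⟨r, r', hr⟩ := hrep y hy
      exact ⟨r, fun _ => ⟨r', hr⟩⟩
    · exact ⟨1, fun h => absurd h hS⟩
  choose ρ hρ using hrep'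
  set S : ℕ → Set M := fun x => Set.range (iprod b x k * ·) with hS
  have hρS : ∀ x, c ≤ x → x < k → ∃ r', ρ (S x) ∈ J ∧ ρ (S x) * f = ρ (S x) ∧
      r' * ρ (S x) = f ∧ Set.range (ρ (S x) * ·) = S x :=
    fun x hx hxk => hρ (S x) ⟨iprod b x k, hmem hx hxk le_rfl, rfl⟩
  have hback : ∀ x, c ≤ x → x < k → ∃ m, P x * m = f := by
    intro x hx hxk
    obtain ⟨m, hm⟩ := h.exists_mul_right hfJ (hPJ x hx hxk.le)
    exact ⟨m, hm⟩
  have hsrange : ∀ x, c ≤ x → x < k → Set.range (ρ (S x) * P x * ·) = S x := by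
    intro x hx hxk
    obtain ⟨r', _, hr2, _, hr4⟩ := hρS x hx hxk
    obtain ⟨m, hm⟩ := hback x hx hxk
    conv_rhs => rw [← hr4]
    apply Set.Subset.antisymm
    · rintro _ ⟨a, rfl⟩
      exact ⟨P x * a, by simp only [mul_assoc]⟩
    · rintro _ ⟨a, rfl⟩
      refine ⟨m * a, ?_⟩
      simp only
      rw [← mul_assoc, mul_assoc _ (P x), hm, hr2]
  -- This one element of `J` encodes a pair: its right class is `S x`, that of the suffix at `x`,
  -- and `P x` is recovered by cancelling the representative. This is why `|J|` colours suffice.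
  refine ⟨fun x => ρ (S x) * P x, fun x hx hxk => ?_, ?_⟩
  · obtain ⟨r', hr1, hr2, hr3, hr4⟩ := hρS x hx hxk
    obtain ⟨m, hm⟩ := hback x hx hxk
    refine h.mem_of_mul_mem_left (b := m) (h.ideal.mul_right _ (h.subset hr1)) ?_
    rw [mul_assoc, hm, hr2]
    exact hr1
  · have hinj : ∀ x y, c ≤ x → x < k → c ≤ y → y < k → ρ (S x) * P x = ρ (S y) * P y →
        S x = S y ∧ P x = P y := by
      intro x y hx hxk hy hyk hxy
      have h1 : S x = S y := by rw [← hsrange x hx hxk, hxy, hsrange y hy hyk]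
      refine ⟨h1, ?_⟩
      rw [← h1] at hxy
      obtain ⟨r', _, _, hr3, _⟩ := hρS x hx hxk
      rw [← hfP x, ← hfP y, ← hr3, mul_assoc, hxy, mul_assoc]
    have hidem : ∀ x y, c ≤ x → x < y → y < k → P x = P y →
        ∃ d, d * P x = iprod b x y ∧ P x * iprod b x y = P x := by
      intro x y hx hxy hyk hP'
      have h1 : P x * iprod b x y = P x := by rw [hPmul hx hxy.le, hP']
      obtain ⟨d, hd⟩ := h.exists_mul_left (hmem hx hxy hyk.le)
        (h1.symm ▸ hPJ x hx (by omega) : P x * iprod b x y ∈ J)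
      exact ⟨d, by rwa [h1] at hd, h1⟩
    intro x y x' y' hx hxy hyk hx' hxy' hyk' hs hs' hs''
    obtain ⟨hS1, hP1⟩ := hinj x y hx (by omega) (by omega) hyk hs
    obtain ⟨hS2, hP2⟩ := hinj x' x hx' (by omega) hx (by omega) hs'
    obtain ⟨hS3, hP3⟩ := hinj y' x (by omega) hyk' hx (by omega) hs''
    obtain ⟨d, hd1, hd2⟩ := hidem x y hx hxy hyk hP1
    obtain ⟨d', hd1', hd2'⟩ := hidem x' y' hx' hxy' hyk' (hP2.trans hP3.symm)
    -- Factors between positions of one colour are left multiples of the common `P x` and fix it on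
    -- the right, so each is idempotent and they share a left class. They also share the right class
    -- `S x`, and idempotents with the same left and right classes are equal.
    have hi : iprod b x y * iprod b x y = iprod b x y := by
      conv_lhs => rw [← hd1]
      rw [mul_assoc, hd1, hd2, hd1]
    have h1 : iprod b x y * iprod b x' y' = iprod b x y := by
      conv_lhs => rw [← hd1]
      rw [← hP2, mul_assoc, hd2', hP2, hd1]
    have hrr : ∀ x y, c ≤ x → x < y → y < k → S x = Set.range (iprod b x y * ·) := by
      intro x y hx hxy hyk
      have h2 : iprod b x y * iprod b y k = iprod b x k := iprod_mul b hxy.le hyk.le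
      obtain ⟨m, hm⟩ := h.exists_mul_right (hmem hx hxy hyk.le)
        (h2.symm ▸ hmem hx (by omega) le_rfl : iprod b x y * iprod b y k ∈ J)
      rw [h2] at hm
      apply Set.Subset.antisymm
      · rintro _ ⟨a, rfl⟩
        refine ⟨iprod b y k * a, ?_⟩
        simp only
        rw [← mul_assoc, h2]
      · rintro _ ⟨a, rfl⟩
        refine ⟨m * a, ?_⟩
        simp only
        rw [← mul_assoc, hm]
    obtain ⟨a, ha⟩ : iprod b x' y' ∈ Set.range (iprod b x y * ·) := by
      rw [← hrr x y hx hxy hyk, ← hS2, hrr x' y' hx' hxy' hyk']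
      exact ⟨1, mul_one _⟩
    simp only at ha
    refine ⟨hi, ?_⟩
    rw [← h1, ← ha, ← mul_assoc, hi]

end IsLayer

theorem exists_boundaries_of_reflTransGen {S : ℕ → ℕ → Prop} {x y : ℕ}
    (h : Relation.ReflTransGen S x y) :
    ∃ (m : ℕ) (C : ℕ → ℕ), C 0 = x ∧ C m = y ∧ ∀ i < m, S (C i) (C (i + 1)) := by
  induction h with
  | refl => exact ⟨0, fun _ => x, rfl, rfl, fun i hi => absurd hi (Nat.not_lt_zero i)⟩
  | tail _ hstep ih =>
    rename_i y z _
    obtain ⟨m, C, h0, hm, hC⟩ := ih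
    refine ⟨m + 1, fun i => if i ≤ m then C i else z, by simp [h0], by simp, fun i hi => ?_⟩
    rcases Nat.lt_succ_iff_lt_or_eq.mp hi with h | h
    · simp only [if_pos h.le, if_pos (Nat.succ_le_of_lt h)]
      exact hC i h
    · subst h
      simpa [hm] using hstep

end Existence

end StabilisationMonoid

namespace StabilisationMonoid

section Existence

variable {M : Type*} [StabilisationMonoid M] {n : ℕ}

/-! ### Existence of computations of bounded height -/

theorem exists_last {P : ℕ → Prop} {x y z : ℕ} (hxz : x ≤ z) (hzy : z < y) (hz : P z) :
    ∃ v, x ≤ v ∧ v < y ∧ P v ∧ ∀ t, v < t → t < y → ¬ P t := by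
  classical
  obtain ⟨v, hv, hmax⟩ := ((Finset.Ico x y).filter P).exists_max_image id
    ⟨z, by simp [hxz, hzy, hz]⟩
  simp only [Finset.mem_filter, Finset.mem_Ico, id] at hv hmax
  exact ⟨v, hv.1.1, hv.1.2, hv.2, fun t h1 h2 h3 => by have := hmax t ⟨⟨by omega, h2⟩, h3⟩; omega⟩

theorem exists_first {P : ℕ → Prop} {x y z : ℕ} (hxz : x ≤ z) (hzy : z < y) (hz : P z) :
    ∃ v, x ≤ v ∧ v < y ∧ P v ∧ ∀ t, x ≤ t → t < v → ¬ P t := by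
  classical
  obtain ⟨v, hv, hmin⟩ := ((Finset.Ico x y).filter P).exists_min_image id
    ⟨z, by simp [hxz, hzy, hz]⟩
  simp only [Finset.mem_filter, Finset.mem_Ico, id] at hv hmin
  exact ⟨v, hv.1.1, hv.1.2, hv.2, fun t h1 h2 h3 => by have := hmin t ⟨⟨h1, by omega⟩, h3⟩; omega⟩

/-- The positions of colour `γ` cut a factor into factors with the same idempotent product, to be
gathered in a single node. -/
theorem IsLayer.seg_group {K J : Set M} (h : IsLayer K J) {b : ℕ → M} {c k : ℕ}
    (hb : ∀ x, c ≤ x → x < k → b x ∈ K) (hJ : iprod b c k ∈ J) {s : ℕ → M}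
    (hs : ∀ x y x' y', c ≤ x → x < y → y < k → c ≤ x' → x' < y' → y' < k → s x = s y →
        s x' = s x → s y' = s x → IsIdempotentElem (iprod b x y) ∧
          iprod b x' y' = iprod b x y) {H : ℕ}
    (hnf : ∀ x y v, c ≤ x → x < y → y ≤ k → Seg Eq n b H x y v → v ∉ K \ J) {q : ℕ}
    (hq : q + 1 ≤ H) {γ : M} {x z : ℕ} (hcx : c ≤ x) (hxz : x < z) (hzk : z < k) (hx : s x = γ)
    (hz : s z = γ)
    (hseg : ∀ x' y', x ≤ x' → x' < y' → y' ≤ z → (∀ t, x' < t → t < y' → s t ≠ γ) →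
      Seg Eq n b q x' y' (iprod b x' y')) :
    Seg Eq n b (q + 1) x z (iprod b x z) := by
  have hpath : ∀ y, x ≤ y → y ≤ z → s y = γ → Relation.ReflTransGen
      (fun x' y' => x ≤ x' ∧ x' < y' ∧ y' ≤ z ∧ s x' = γ ∧ s y' = γ ∧
        Seg Eq n b q x' y' (iprod b x' y')) x y := by
    intro y
    induction y using Nat.strong_induction_on with
    | _ y ih =>
      intro hxy hyz hy
      rcases hxy.eq_or_lt with rfl | hlt
      · exact .refl
      · obtain ⟨y', h1, h2, h3, h4⟩ := exists_last (P := fun t => s t = γ) le_rfl hlt hx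
        exact (ih y' h2 h1 (by omega) h3).tail
          ⟨h1, h2, hyz, h3, hy, hseg y' y h1 h2 hyz h4⟩
  obtain ⟨m, C, h0, hm, hC⟩ := exists_boundaries_of_reflTransGen (hpath z hxz.le le_rfl hz)
  have hxm : m ≠ 0 := by
    rintro rfl
    omega
  obtain ⟨hidem, _⟩ := hs x z x z hcx hxz hzk hcx hxz hzk (hx.trans hz.symm) rfl (hz.trans hx.symm)
  have hval : ∀ i < m, Seg Eq n b q (C i) (C (i + 1)) (iprod b x z) := by
    intro i hi
    obtain ⟨h1, h2, h3, h4, h5, h6⟩ := hC i hi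
    rwa [(hs x z (C i) (C (i + 1)) hcx hxz hzk (by omega) h2 (by omega) (hx.trans hz.symm)
      (h4.trans hx.symm) (h5.trans hx.symm)).2] at h6
  by_cases hm1 : m = 1
  · subst hm1
    have := hval 0 (by omega)
    rw [h0, zero_add, hm] at this
    exact this.mono (by omega)
  by_cases hmn : m ≤ n
  · have := Seg.idem q m C _ _ (by omega) hmn hidem hval rfl
    rwa [h0, hm] at this
  · have hst := Seg.stab q m C _ _ (by omega) hidem hval rfl
    rw [h0, hm] at hst
    -- More than `n` children call for a stabilisation node. A fall is excluded by `hnf`, so its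
    -- value is still the product.
    rcases h.sharp_eq_or_mem (h.iprod_mem hb hJ hcx hxz hzk.le) hidem with heq | hmem
    · rwa [heq] at hst
    · exact absurd hmem (hnf x z _ hcx hxz hzk.le (hst.mono hq))

/-- Induction on the colours allowed at inner positions. All positions of one colour `γ` are used as
cuts: one node gathers the factors between the first and the last, and two binary nodes attach the
ends, hence three levels per colour. -/
theorem IsLayer.seg_of_colours {K J : Set M} (h : IsLayer K J) {b : ℕ → M} {c k : ℕ}
    (hb : ∀ x, c ≤ x → x < k → b x ∈ K) (hJ : iprod b c k ∈ J) {s : ℕ → M}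
    (hs : ∀ x y x' y', c ≤ x → x < y → y < k → c ≤ x' → x' < y' → y' < k → s x = s y →
        s x' = s x → s y' = s x → IsIdempotentElem (iprod b x y) ∧
          iprod b x' y' = iprod b x y) {H : ℕ}
    (hnf : ∀ x y v, c ≤ x → x < y → y ≤ k → Seg Eq n b H x y v → v ∉ K \ J)
    (T : Finset M) (hT : 3 * T.card ≤ H + 1) {x y : ℕ} (hx : c ≤ x) (hxy : x < y) (hy : y ≤ k)
    (hcol : ∀ z, x < z → z < y → s z ∈ T) : Seg Eq n b (3 * T.card) x y (iprod b x y) := by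
  classical
  induction T using Finset.strongInduction generalizing x y with
  | H T ih =>
    rcases (Nat.succ_le_of_lt hxy).eq_or_lt with rfl | hlt
    · exact .leaf _ _ _ (iprod_succ b x)
    · simp only [Nat.succ_eq_add_one] at hlt
      set γ := s (x + 1) with hγ
      have hγT : γ ∈ T := hcol _ (by omega) hlt
      have hcard := Finset.card_erase_add_one hγT
      have hpos : 0 < T.card := Finset.card_pos.mpr ⟨γ, hγT⟩
      have hsub : ∀ x' y', x ≤ x' → x' < y' → y' ≤ y → (∀ t, x' < t → t < y' → s t ≠ γ) →
          Seg Eq n b (3 * (T.erase γ).card) x' y' (iprod b x' y') := fun x' y' h1 h2 h3 h4 =>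
        ih (T.erase γ) (Finset.erase_ssubset hγT) (by omega) (by omega) h2 (by omega)
          fun z hz1 hz2 => Finset.mem_erase.mpr ⟨h4 z hz1 hz2, hcol z (by omega) (by omega)⟩
      obtain ⟨u, hxu, huy, hu, hu'⟩ := exists_first (P := fun t => s t = γ) (x := x + 1) le_rfl
        hlt rfl
      obtain ⟨v, huv, hvy, hv, hv'⟩ := exists_last (P := fun t => s t = γ) le_rfl huy hu
      have s1 := hsub x u le_rfl (by omega) (by omega) fun t h1 h2 => hu' t h1 h2
      have s2 := hsub v y (by omega) hvy le_rfl hv'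
      have s3 : Seg Eq n b (3 * (T.erase γ).card + 2) x v (iprod b x v) := by
        rcases huv.eq_or_lt with rfl | huv'
        · exact s1.mono (by omega)
        · refine .binary _ _ _ _ _ _ _ (s1.mono (by omega)) ?_ (iprod_mul b (by omega) huv).symm
          refine h.seg_group hb hJ hs hnf (by omega) (by omega) huv' (by omega) hu hv ?_
          exact fun x' y' h1 h2 h3 h4 => hsub x' y' (by omega) h2 (by omega) h4
      have := Seg.binary _ _ _ _ _ _ _ s3 (s2.mono (by omega))
        (iprod_mul b (show x ≤ v by omega) hvy.le).symm
      exact this.mono (by omega)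

/-- A word all of whose factors have their product in `J` has a computation of height less than
`3 |J|`, unless some factor has a computation of value below `J`. -/
theorem IsLayer.seg_smooth {K J : Set M} (h : IsLayer K J) {b : ℕ → M} {c k : ℕ} (hck : c < k)
    (hb : ∀ x, c ≤ x → x < k → b x ∈ K) (hJ : iprod b c k ∈ J)
    (hnf : ∀ x y v, c ≤ x → x < y → y ≤ k → Seg Eq n b (3 * J.ncard - 1) x y v → v ∉ K \ J) :
    Seg Eq n b (3 * J.ncard - 1) c k (iprod b c k) := by
  classical
  have : Finite M := StabilisationMonoid.finite
  rcases (Nat.succ_le_of_lt hck).eq_or_lt with rfl | hlt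
  · exact .leaf _ _ _ (iprod_succ b c)
  · simp only [Nat.succ_eq_add_one] at hlt
    obtain ⟨s, hsJ, hs⟩ := h.exists_colouring hlt hb hJ
    set T := J.toFinite.toFinset with hT
    have hTcard : T.card = J.ncard := (Set.ncard_eq_toFinset_card J).symm
    -- Starting with the colour of the left end spares one binary node, which is the `- 1` in the
    -- height. Later arguments spend this spare level on a multiplication.
    set γ := s c with hγ
    have hγT : γ ∈ T := by simpa [hT] using hsJ c le_rfl hck
    have hcard := Finset.card_erase_add_one hγT
    have hsub : ∀ x y, c ≤ x → x < y → y ≤ k → (∀ t, x < t → t < y → s t ≠ γ) →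
        Seg Eq n b (3 * (T.erase γ).card) x y (iprod b x y) := by
      intro x y hx hxy hy hne
      refine h.seg_of_colours hb hJ hs hnf _ (by omega) hx hxy hy fun z hz1 hz2 => ?_
      exact Finset.mem_erase.mpr ⟨hne z hz1 hz2, by simpa [hT] using hsJ z (by omega) (by omega)⟩
    obtain ⟨v, hcv, hvk, hv, hv'⟩ := exists_last (P := fun t => s t = γ) le_rfl hck rfl
    have s1 := hsub v k hcv hvk le_rfl hv'
    rcases hcv.eq_or_lt with rfl | hcv
    · exact s1.mono (by omega)
    · have s2 : Seg Eq n b (3 * (T.erase γ).card + 1) c v (iprod b c v) :=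
        h.seg_group hb hJ hs hnf (by omega) le_rfl hcv hvk rfl hv
          fun x' y' h1 h2 h3 h4 => hsub x' y' h1 h2 (by omega) h4
      have := Seg.binary _ _ _ _ _ _ _ s2 (s1.mono (by omega))
        (iprod_mul b hcv.le hvk.le).symm
      exact this.mono (by omega)

theorem IsLayer.ncard_pos {K J : Set M} (h : IsLayer K J) : 0 < J.ncard := by
  have : Finite M := StabilisationMonoid.finite
  exact (Set.ncard_pos J.toFinite).mpr h.nonempty

/-- If no prefix falls below `J`, all prefix products remain in `J`, by induction on the length, and
the smooth case applies to each prefix. -/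
theorem IsLayer.exists_fall_or_seg {K J : Set M} (h : IsLayer K J) {b : ℕ → M} {c m : ℕ}
    (hcm : c < m) (hb : ∀ x, c ≤ x → x < m → b x ∈ K) :
    (∃ y, c < y ∧ y ≤ m ∧ ∃ v ∈ K \ J, Seg Eq n b (3 * J.ncard) c y v) ∨
      ∃ v ∈ J, Seg Eq n b (3 * J.ncard - 1) c m v := by
  have hpos := h.ncard_pos
  by_contra! hcon
  obtain ⟨hfall, hcon⟩ := hcon
  have key : ∀ y, c < y → y ≤ m → iprod b c y ∈ J ∧
      Seg Eq n b (3 * J.ncard - 1) c y (iprod b c y) := by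
    intro y
    induction y using Nat.strong_induction_on with
    | _ y ih =>
      intro hcy hym
      have hJ : iprod b c y ∈ J := by
        by_contra hnot
        obtain ⟨z, rfl⟩ : ∃ z, y = z + 1 := ⟨y - 1, by omega⟩
        have hcz : c ≤ z := by omega
        have hprod : iprod b c (z + 1) = iprod b c z * b z := by
          rw [← iprod_mul b hcz (Nat.le_succ z), Nat.succ_eq_add_one, iprod_succ]
        have hK : iprod b c (z + 1) ∈ K := by
          rw [hprod]
          exact h.ideal.mul_left _ (hb z hcz (by omega))
        refine hfall _ hcy hym _ ⟨hK, hnot⟩ ?_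
        rcases hcz.eq_or_lt with rfl | hlt
        · exact .leaf _ _ _ (iprod_succ b c)
        · have h1 := (ih z (by omega) hlt (by omega)).2
          exact (Seg.binary _ _ _ _ _ _ _ h1 (.leaf _ _ _ rfl) hprod).mono (by omega)
      refine ⟨hJ, h.seg_smooth hcy (fun x h1 h2 => hb x h1 (by omega)) hJ ?_⟩
      intro x z v hx hxz hz hseg hv
      -- A fall on an inner factor gives one on a prefix: the computation of what precedes it is
      -- multiplied in, and `K \ J` is an ideal.
      rcases hx.eq_or_lt with rfl | hlt
      · exact hfall z hxz (by omega) v hv (hseg.mono (by omega))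
      · have h1 := (ih x (by omega) hlt (by omega)).2
        exact hfall z (by omega) (by omega) _ (h.rest.mul_left _ hv)
          ((Seg.binary _ _ _ _ _ _ _ h1 hseg rfl).mono (by omega))
  exact hcon _ (key m hcm le_rfl).1 (key m hcm le_rfl).2

theorem IsLayer.exists_path {K J : Set M} (h : IsLayer K J) {b : ℕ → M} {c m : ℕ}
    (hcm : c ≤ m) (hb : ∀ x, c ≤ x → x < m → b x ∈ K) :
    ∃ d, d ≤ m ∧ Relation.ReflTransGen
      (fun x y => y ≤ m ∧ ∃ v ∈ K \ J, Seg Eq n b (3 * J.ncard) x y v) c d ∧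
      (d = m ∨ ∃ v ∈ J, Seg Eq n b (3 * J.ncard - 1) d m v) := by
  induction hr : m - c using Nat.strong_induction_on generalizing c with
  | _ r ih =>
    rcases hcm.eq_or_lt with rfl | hlt
    · exact ⟨c, le_rfl, .refl, .inl rfl⟩
    rcases h.exists_fall_or_seg (n := n) hlt hb with ⟨y, h1, h2, h3⟩ | h1
    · obtain ⟨d, hd, hp, hend⟩ := ih (m - y) (by omega) h2 (fun x hx1 hx2 => hb x (by omega) hx2) rfl
      exact ⟨d, hd, .head ⟨h2, h3⟩ hp, hend⟩
    · exact ⟨c, hcm, .refl, .inr h1⟩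

/-- The factor `w 0, …, w (N - 1)` decomposes into factors which have computations of height at
most `3 |M \ K|` and value in `K`, followed by at most one of value outside `K`. -/
def HasDecomposition (n : ℕ) (w : ℕ → M) (N : ℕ) (K : Set M) : Prop :=
  ∃ d, Relation.ReflTransGen (fun x y => ∃ v ∈ K, Seg Eq n w (3 * Kᶜ.ncard) x y v) 0 d ∧
    (d = N ∨ ∃ v ∉ K, Seg Eq n w (3 * Kᶜ.ncard) d N v)

theorem hasDecomposition_univ (n : ℕ) (w : ℕ → M) (N : ℕ) :
    HasDecomposition n w N (Set.univ : Set M) := by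
  refine ⟨N, ?_, .inl rfl⟩
  induction N with
  | zero => exact .refl
  | succ N ih => exact ih.tail ⟨w N, trivial, .leaf _ _ _ rfl⟩

/-- The values of the factors already found form a word over `K`. It is decomposed by
`IsLayer.exists_path`, and substituting the old computations for its letters adds up the heights. -/
theorem IsLayer.hasDecomposition {K J : Set M} (h : IsLayer K J) {w : ℕ → M} {N : ℕ}
    (hK : HasDecomposition n w N K) : HasDecomposition n w N (K \ J) := by
  have : Finite M := StabilisationMonoid.finite
  have hpos := h.ncard_pos
  have hcard : (K \ J)ᶜ.ncard = Kᶜ.ncard + J.ncard := by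
    rw [Set.sdiff_eq, Set.compl_inter, compl_compl, Set.ncard_union_eq]
    exact Set.disjoint_left.mpr fun x hx hx' => hx (h.subset hx')
  obtain ⟨d, hpath, hend⟩ := hK
  obtain ⟨m, B, h0, hm, hB⟩ := exists_boundaries_of_reflTransGen hpath
  have hB' : ∀ i, ∃ v, i < m → v ∈ K ∧ Seg Eq n w (3 * Kᶜ.ncard) (B i) (B (i + 1)) v := by
    intro i
    by_cases hi : i < m
    · obtain ⟨v, hv⟩ := hB i hi
      exact ⟨v, fun _ => hv⟩
    · exact ⟨1, fun h => absurd h hi⟩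
  choose b hb using hB'
  obtain ⟨d', hd', hpath', hend'⟩ := h.exists_path (n := n) (b := b) (Nat.zero_le m)
    fun x _ hx => (hb x hx).1
  have hsub : ∀ {p x y v}, Seg Eq n b p x y v → y ≤ m →
      Seg Eq n w (p + 3 * Kᶜ.ncard) (B x) (B y) v :=
    fun hseg hy => hseg.subst (fun i hi => (hb i hi).2) hy
  have hmain : Relation.ReflTransGen
      (fun x y => ∃ v ∈ K \ J, Seg Eq n w (3 * (K \ J)ᶜ.ncard) x y v) 0 (B d') := by
    rw [← h0]
    refine hpath'.lift B ?_
    rintro x y ⟨hy, v, hv, hseg⟩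
    exact ⟨v, hv, (hsub hseg hy).mono (by omega)⟩
  rcases hend' with rfl | ⟨v, hv, hseg⟩
  · refine ⟨B d', hmain, ?_⟩
    rw [hm]
    rcases hend with hd | ⟨t, ht, hseg⟩
    · exact .inl hd
    · exact .inr ⟨t, fun h' => ht h'.1, hseg.mono (by omega)⟩
  · have hseg' := hsub hseg le_rfl
    rw [hm] at hseg'
    rcases hend with rfl | ⟨t, ht, ht'⟩
    · exact ⟨B d', hmain, .inr ⟨v, fun h' => h'.2 hv, hseg'.mono (by omega)⟩⟩
    -- A remainder in `J` and the old remainder outside `K` are merged into one, on the spare level.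
    · have hprod : Seg Eq n w (3 * (K \ J)ᶜ.ncard) (B d') N (v * t) :=
        (Seg.binary _ _ _ _ _ _ _ hseg' (ht'.mono (by omega)) rfl).mono (by omega)
      by_cases hvt : v * t ∈ K \ J
      · exact ⟨N, hmain.tail ⟨_, hvt, hprod⟩, .inl rfl⟩
      · exact ⟨B d', hmain, .inr ⟨_, hvt, hprod⟩⟩

/-- Every word has an `n`-computation of height at most `3 |M|`. -/
theorem exists_seg (n : ℕ) (w : ℕ → M) (N : ℕ) :
    ∃ v, Seg Eq n w (3 * Nat.card M) 0 N v := by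
  have : Finite M := StabilisationMonoid.finite
  have key : ∀ K : Set M, IsTwoSided K → HasDecomposition n w N K →
      HasDecomposition n w N (∅ : Set M) := by
    intro K
    induction hr : K.ncard using Nat.strong_induction_on generalizing K with
    | _ r ih =>
      intro hK hdec
      rcases K.eq_empty_or_nonempty with rfl | hne
      · exact hdec
      · obtain ⟨J, hJ⟩ := hK.exists_layer hne
        refine ih _ ?_ (K \ J) rfl hJ.rest (hJ.hasDecomposition hdec)
        rw [← hr]
        refine Set.ncard_lt_ncard ⟨Set.sdiff_subset, fun hsub => ?_⟩ K.toFinite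
        obtain ⟨x, hx⟩ := hJ.nonempty
        exact (hsub (hJ.subset hx)).2 hx
  -- Removing layers from the whole monoid ends at the empty ideal, where no factor can have a value
  -- and only the remainder is left: the whole word.
  obtain ⟨d, hpath, hend⟩ := key Set.univ ⟨fun _ _ _ => trivial, fun _ _ => trivial⟩
    (hasDecomposition_univ n w N)
  have hd : d = 0 := by
    rcases Relation.ReflTransGen.cases_tail hpath with h | ⟨_, _, v, hv, _⟩
    · exact h
    · exact absurd hv (Set.notMem_empty v)
  subst hd
  rcases hend with rfl | ⟨v, _, hseg⟩
  · exact ⟨1, .nil _ _ _ rfl⟩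
  · exact ⟨v, by simpa using hseg⟩

end Existence

end StabilisationMonoid

/-! ### The domination preorder -/

section Domination

variable {E : Type*} {f g h : E → ℕ∞}

/-- The extension of `α : ℕ → ℕ` by `∞ ↦ ∞`, as a self-map of `ℕ∞`. -/
def extendTop (α : ℕ → ℕ) (x : ℕ∞) : ℕ∞ := ENat.map α x

@[simp] theorem extendTop_top (α : ℕ → ℕ) : extendTop α ⊤ = ⊤ := rfl

@[simp] theorem extendTop_coe (α : ℕ → ℕ) (n : ℕ) : extendTop α n = (α n : ℕ) := rfl

theorem dominatedBy_iff {α : ℕ → ℕ} : DominatedBy α f g ↔ ∀ x, f x ≤ extendTop α (g x) := Iff.rfl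

theorem extendTop_le_extendTop {α β : ℕ → ℕ} (hαβ : ∀ n, α n ≤ β n) (x : ℕ∞) :
    extendTop α x ≤ extendTop β x := by
  induction x using ENat.recTopCoe with
  | top => simp
  | coe n => simpa using hαβ n

theorem extendTop_id (x : ℕ∞) : extendTop id x = x := by
  induction x using ENat.recTopCoe with
  | top => simp
  | coe n => simp

theorem extendTop_mono {α : ℕ → ℕ} (hα : Monotone α) : Monotone (extendTop α) := by
  intro x y hxy
  induction y using ENat.recTopCoe with
  | top => simp
  | coe n =>
    induction x using ENat.recTopCoe with
    | top => simp at hxy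
    | coe m => simpa using hα (by simpa using hxy)

theorem IsCorrection.id : IsCorrection id := ⟨monotone_id, fun _ => le_rfl⟩

theorem exists_isCorrection_ge (N : ℕ → ℕ) : ∃ α, IsCorrection α ∧ ∀ n, N n ≤ α n := by
  refine ⟨fun n => n + ∑ i ∈ Finset.range (n + 1), N i, ⟨fun m n hmn => ?_, fun n => ?_⟩,
    fun n => ?_⟩
  · exact add_le_add hmn (Finset.sum_le_sum_of_subset (Finset.range_mono (by omega)))
  · exact Nat.le_add_right _ _
  · exact (Finset.single_le_sum (fun i _ => Nat.zero_le (N i))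
      (Finset.self_mem_range_succ n)).trans (Nat.le_add_left _ _)

theorem dominated_of_le (hfg : ∀ x, f x ≤ g x) : Dominated f g :=
  ⟨id, .id, dominatedBy_iff.mpr fun x => (hfg x).trans (extendTop_id _).ge⟩

theorem Dominated.trans (hfg : Dominated f g) (hgh : Dominated g h) : Dominated f h := by
  obtain ⟨α, hα, h1⟩ := hfg
  obtain ⟨β, hβ, h2⟩ := hgh
  refine ⟨α ∘ β, ⟨hα.1.comp hβ.1, fun n => (hβ.2 n).trans (hα.2 _)⟩,
    dominatedBy_iff.mpr fun x => ?_⟩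
  refine (dominatedBy_iff.mp h1 x).trans
    ((extendTop_mono hα.1 (dominatedBy_iff.mp h2 x)).trans (le_of_eq ?_))
  induction h x using ENat.recTopCoe with
  | top => simp
  | coe n => simp

theorem costEquiv_iff : CostEquiv f g ↔ Dominated f g ∧ Dominated g f := by
  constructor
  · rintro ⟨α, hα, h1, h2⟩
    exact ⟨⟨α, hα, h1⟩, ⟨α, hα, h2⟩⟩
  · rintro ⟨⟨α, hα, h1⟩, ⟨β, hβ, h2⟩⟩
    rw [dominatedBy_iff] at h1 h2
    exact ⟨fun n => max (α n) (β n), ⟨hα.1.max hβ.1, fun n => (hα.2 n).trans (le_max_left _ _)⟩,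
      fun x => (h1 x).trans (extendTop_le_extendTop (fun n => le_max_left _ _) _),
      fun x => (h2 x).trans (extendTop_le_extendTop (fun n => le_max_right _ _) _)⟩

theorem Dominated.comp {F : Type*} (hfg : Dominated f g) (φ : F → E) :
    Dominated (fun x => f (φ x)) fun x => g (φ x) := by
  obtain ⟨α, hα, h1⟩ := hfg
  exact ⟨α, hα, fun x => h1 (φ x)⟩

/-- A dominated function is bounded where the dominating one is. -/
theorem Dominated.exists_bound (hfg : Dominated f g) (B : ℕ) :
    ∃ B' : ℕ, ∀ x, g x ≤ B → f x ≤ B' := by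
  obtain ⟨α, hα, h1⟩ := hfg
  exact ⟨α B, fun x hx => (dominatedBy_iff.mp h1 x).trans (extendTop_mono hα.1 hx)⟩

end Domination

namespace StabilisationMonoid

section WellDefined

variable {A M : Type*} [StabilisationMonoid M] (h : A → M) {I : Set M}

/-! ### The recognised cost function -/

theorem HasComp.mono {R : M → M → Prop} {n p q : ℕ} {u : List M} {X : Set M}
    (hc : HasComp R n p u X) (hpq : p ≤ q) : HasComp R n q u X := by
  obtain ⟨v, T, h1, h2, h3, h4⟩ := hc
  exact ⟨v, T, h1, h2, h3.trans hpq, h4⟩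

theorem HasComp.imp {R R' : M → M → Prop} (hR : ∀ a b, R a b → R' a b) {n p : ℕ} {u : List M}
    {X : Set M} (hc : HasComp R n p u X) : HasComp R' n p u X := by
  rw [hasComp_iff] at hc ⊢
  obtain ⟨v, hv, hs⟩ := hc
  exact ⟨v, hv, hs.imp hR⟩

theorem semMinusMinus_le_semMinus (I : Set M) (p : ℕ) (u : List A) :
    semMinusMinus h I p u ≤ semMinus h I p u := by
  refine sInf_le_sInf ?_
  rintro _ ⟨n, rfl, hn⟩
  exact ⟨n, rfl, hn.imp fun _ _ => le_of_eq⟩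

theorem semPlus_le_semPlusPlus (I : Set M) (p : ℕ) (u : List A) :
    semPlus h I p u ≤ semPlusPlus h I p u := by
  refine sSup_le_sSup ?_
  rintro _ ⟨n, rfl, hn⟩
  exact ⟨n, rfl, hn.imp fun _ _ => ge_of_eq⟩

theorem semPlus_mono (I : Set M) {p q : ℕ} (hpq : p ≤ q) (u : List A) :
    semPlus h I p u ≤ semPlus h I q u := by
  refine sSup_le_sSup ?_
  rintro _ ⟨n, rfl, hn⟩
  exact ⟨n, rfl, hn.mono hpq⟩

/-- If `+` is a finite `N`, the `N`-computation provided by `exists_seg` cannot have its value in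
`I`, as `+` would be at least `N + 1`. So it witnesses that `-` is at most `N`. -/
theorem semMinus_le_semPlus (I : Set M) {p : ℕ} (hp : 3 * Nat.card M ≤ p) (u : List A) :
    semMinus h I p u ≤ semPlus h I (3 * Nat.card M) u := by
  induction hN : semPlus h I (3 * Nat.card M) u using ENat.recTopCoe with
  | top => exact le_top
  | coe N =>
    obtain ⟨v, hv⟩ := exists_seg N (extend (u.map h)) (u.map h).length
    refine sInf_le ⟨N, rfl, hasComp_iff.mpr ⟨v, fun hvI => ?_, hv.mono hp⟩⟩
    have hle : ((N : ℕ∞) + 1) ≤ semPlus h I (3 * Nat.card M) u :=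
      le_sSup ⟨N, rfl, hasComp_iff.mpr ⟨v, hvI, hv⟩⟩
    rw [hN] at hle
    exact absurd (by exact_mod_cast hle : N + 1 ≤ N) (by omega)

/-- If the threshold of an over-computation of value in `I` exceeded `N n`, uniqueness would put
below it, hence in `I`, the value of the `n`-under-computation that avoids `I`. The thresholds `N n`
are majorised by a correction function. -/
theorem semPlusPlus_dominated (hI : IsLowerSet I) (p : ℕ) :
    Dominated (semPlusPlus h I p) (semMinusMinus h I p) := by
  choose N hN using fun n => exists_threshold M n p p
  obtain ⟨α, hα, hαN⟩ := exists_isCorrection_ge N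
  refine ⟨α, hα, dominatedBy_iff.mpr fun u => ?_⟩
  induction hn : semMinusMinus h I p u using ENat.recTopCoe with
  | top => simp
  | coe n =>
    have hne : {x : ℕ∞ | ∃ n : ℕ, x = n ∧ HasComp (· ≤ ·) n p (u.map h) Iᶜ}.Nonempty := by
      by_contra hcon
      rw [Set.not_nonempty_iff_eq_empty] at hcon
      rw [semMinusMinus, hcon, sInf_empty] at hn
      exact ENat.top_ne_natCast n hn
    obtain ⟨m, hm, hcomp⟩ := csInf_mem hne
    obtain rfl : n = m := by
      rw [semMinusMinus, hm] at hn
      exact_mod_cast hn.symm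
    obtain ⟨a, ha, hsa⟩ := hasComp_iff.mp hcomp
    refine sSup_le ?_
    rintro _ ⟨m, rfl, hm⟩
    obtain ⟨b, hb, hsb⟩ := hasComp_iff.mp hm
    have hlt : m < N n := by
      by_contra hcon
      exact ha (hI (hN n m (not_lt.mp hcon) _ _ _ _ _ hsa hsb) hb)
    rw [extendTop_coe]
    exact_mod_cast (Nat.succ_le_of_lt hlt).trans (hαN n)

theorem dominated_cycle (hI : IsLowerSet I) {p : ℕ} (hp : 3 * Nat.card M ≤ p) :
    Dominated (semMinusMinus h I p) (semMinus h I p) ∧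
    Dominated (semMinus h I p) (semPlus h I (3 * Nat.card M)) ∧
    Dominated (semPlus h I (3 * Nat.card M)) (semPlus h I p) ∧
    Dominated (semPlus h I p) (semPlusPlus h I p) ∧
    Dominated (semPlusPlus h I p) (semMinusMinus h I p) :=
  ⟨dominated_of_le (semMinusMinus_le_semMinus h I p), dominated_of_le (semMinus_le_semPlus h I hp),
    dominated_of_le (semPlus_mono h I hp), dominated_of_le (semPlus_le_semPlusPlus h I p),
    semPlusPlus_dominated h hI p⟩

theorem sem_mem_costFunction (hI : IsLowerSet I) {p : ℕ} (hp : 3 * Nat.card M ≤ p) :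
    semMinusMinus h I p ∈ costFunction h I ∧ semMinus h I p ∈ costFunction h I ∧
    semPlus h I p ∈ costFunction h I ∧ semPlusPlus h I p ∈ costFunction h I := by
  obtain ⟨h1, h2, h3, h4, h5⟩ := dominated_cycle h hI hp
  simp only [costFunction, Set.mem_ofPred_eq, costEquiv_iff]
  exact ⟨⟨h1.trans h2, (h3.trans h4).trans h5⟩, ⟨h2, ((h3.trans h4).trans h5).trans h1⟩,
    ⟨((h4.trans h5).trans h1).trans h2, h3⟩, ⟨(h5.trans h1).trans h2, h3.trans h4⟩⟩

end WellDefined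

end StabilisationMonoid

namespace StabilisationMonoid

section Criterion

variable {A M : Type*} [StabilisationMonoid M]

/-! ### Computations of unfoldings -/

theorem HasComp.append {t p : ℕ} {u u' : List M} {a b : M} (hu : HasComp Eq t p u {a})
    (hu' : HasComp Eq t p u' {b}) : HasComp Eq t (p + 1) (u ++ u') {a * b} := by
  obtain ⟨v, T, hd, hT, hp, rfl⟩ := hu
  obtain ⟨v', T', hd', hT', hp', rfl⟩ := hu'
  refine ⟨v ++ v', .node (T.value * T'.value) 2 ![T, T'], hd.append hd',
    ⟨⟨![v, v'], by simp [List.ofFn_succ], ?_⟩, .inl ⟨rfl, by simp [List.ofFn_succ]⟩⟩, ?_, rfl⟩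
  · intro i
    fin_cases i
    · exact hT
    · exact hT'
  · simp only [CompTree.height, add_le_add_iff_right, Finset.sup_le_iff]
    intro i _
    fin_cases i
    · exact hp
    · exact hp'

theorem HasComp.sharp {t p k : ℕ} {u : List M} {e : M} (hu : HasComp Eq t p u {e})
    (he : IsIdempotentElem e) (hk : t < k) :
    HasComp Eq t (p + 1) (List.replicate k u).flatten {sharp e} := by
  obtain ⟨v, T, hd, hT, hp, rfl⟩ := hu
  refine ⟨(List.ofFn fun _ : Fin k => v).flatten, .node _ k fun _ => T, ?_,
    ⟨⟨fun _ => v, rfl, fun _ => hT⟩, .inr (.inr ⟨hk, T.value, he, fun _ => rfl, rfl⟩)⟩, ?_, rfl⟩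
  · rw [← List.ofFn_const]
    exact DeletesOnes.ofFn fun _ => hd
  · simpa only [CompTree.height, add_le_add_iff_right, Finset.sup_le_iff] using fun _ _ => hp

theorem HasComp.pow {t p : ℕ} {u : List M} {a : M} (hu : HasComp Eq t p u {a}) (k : ℕ) :
    HasComp Eq t (p + k) (List.replicate (k + 1) u).flatten {a ^ (k + 1)} := by
  induction k with
  | zero => simpa using hu
  | succ k ih =>
    rw [List.replicate_succ, List.flatten_cons, pow_succ', ← add_assoc]
    exact (hu.mono (Nat.le_add_right p k)).append ih

theorem flatten_replicate_mul {X : Type*} (a b : ℕ) (u : List X) :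
    (List.replicate (a * b) u).flatten =
      (List.replicate b (List.replicate a u).flatten).flatten := by
  induction b with
  | zero => simp
  | succ b ih =>
    rw [Nat.mul_succ, add_comm, List.replicate_add, List.flatten_append, List.replicate_succ,
      List.flatten_cons, ih]

theorem pow_eq_pow_factorial (a : M) {Ω : ℕ} (hΩ : 0 < Ω) (hdvd : (Nat.card M).factorial ∣ Ω) :
    a ^ Ω = a ^ (Nat.card M).factorial := by
  have : Finite M := StabilisationMonoid.finite
  obtain ⟨c, rfl⟩ := hdvd
  rw [pow_mul]
  exact (isIdempotentElem_pow_factorial a).pow_eq (by rintro rfl; simp at hΩ)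

/-- Unfoldings have computations whose value is that of the expression. -/
theorem exists_hasComp_unfold (h : A → M) (E : SharpExpr A) {Ω : ℕ} (hΩ : 0 < Ω)
    (hdvd : (Nat.card M).factorial ∣ Ω) :
    ∃ p, ∀ n t, t < n → HasComp Eq t p ((E.unfold (Ω * n)).map h) {(E.map h).val} := by
  have : Finite M := StabilisationMonoid.finite
  induction E with
  | letter a =>
    exact ⟨0, fun n t _ => ⟨[h a], .leaf (h a), DeletesOnes.refl _, ⟨h a, rfl, rfl⟩, le_rfl, rfl⟩⟩
  | mul E F ihE ihF =>
    obtain ⟨p, hp⟩ := ihE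
    obtain ⟨q, hq⟩ := ihF
    refine ⟨p + q + 1, fun n t ht => ?_⟩
    simp only [SharpExpr.unfold, SharpExpr.map, SharpExpr.val, List.map_append]
    exact ((hp n t ht).mono (by omega)).append ((hq n t ht).mono (by omega))
  | omegaSharp E ih =>
    obtain ⟨p, hp⟩ := ih
    -- The `Ω n`-th power is read as `n > t` copies of the `Ω`-th power. Only the fixed exponent `Ω`
    -- is computed by binary nodes, so the height does not depend on `n`.
    refine ⟨p + Ω + 1, fun n t ht => ?_⟩
    simp only [SharpExpr.unfold, SharpExpr.map, SharpExpr.val, List.map_flatten, List.map_replicate]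
    rw [flatten_replicate_mul, ← pow_eq_pow_factorial _ hΩ hdvd]
    refine HasComp.sharp ?_ ?_ ht
    · obtain ⟨k, rfl⟩ : ∃ k, Ω = k + 1 := ⟨Ω - 1, by omega⟩
      exact ((hp n t ht).pow k).mono (by omega)
    · rw [pow_eq_pow_factorial _ hΩ hdvd]
      exact isIdempotentElem_pow_factorial _

/-! ### Witnesses of non-domination -/

theorem not_dominated_of_witness {X : Type*} {f g : X → ℕ∞} {w : ℕ → X}
    (hf : ∀ N : ℕ, ∃ n₀, ∀ n ≥ n₀, (N : ℕ∞) ≤ f (w n)) (hg : ∃ B : ℕ, ∀ n ≥ 1, g (w n) ≤ B) :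
    ¬ Dominated f g := by
  intro hd
  obtain ⟨B, hB⟩ := hg
  obtain ⟨B', hB'⟩ := hd.exists_bound B
  obtain ⟨n₀, hn₀⟩ := hf (B' + 1)
  have h1 := hn₀ (n₀ + 1) (by omega)
  have h2 := hB' (w (n₀ + 1)) (hB _ (by omega))
  exact absurd (by exact_mod_cast h1.trans h2 : B' + 1 ≤ B') (by omega)

variable {h : A → M} {I J : Set M} {f g : List A → ℕ∞}

/-- At `w n`, thresholds up to `n - 1` push the function `+` for `I` to at least `n`, while
threshold `0` already makes `-` for `J` vanish. The height `3|M| + p` is admissible for both. -/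
theorem witnesses_of_hasComp (hI : IsLowerSet I) (hJ : IsLowerSet J) (hf : f ∈ costFunction h I)
    (hg : g ∈ costFunction h J) {w : ℕ → List A} {p : ℕ} {c : M} (hc : c ∈ I \ J)
    (hw : ∀ n t, t < n → HasComp Eq t p ((w n).map h) {c}) : WitnessesNonDomination f g w := by
  have hsub : ∀ {t : ℕ} {u : List M} {X : Set M}, c ∈ X → HasComp Eq t p u {c} →
      HasComp Eq t (3 * Nat.card M + p) u X := by
    rintro t u X hX ⟨v, T, h1, h2, h3, rfl⟩
    exact ⟨v, T, h1, h2, h3.trans (Nat.le_add_left _ _), hX⟩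
  have hf' := (sem_mem_costFunction h hI (Nat.le_add_right (3 * Nat.card M) p)).2.2.1
  have hg' := (sem_mem_costFunction h hJ (Nat.le_add_right (3 * Nat.card M) p)).2.1
  simp only [costFunction, Set.mem_ofPred_eq, costEquiv_iff] at hf hg hf' hg'
  constructor
  · intro N
    obtain ⟨B, hB⟩ := (hf'.1.trans hf.2).exists_bound N
    refine ⟨B + 1, fun n hn => le_of_not_ge fun hcon => ?_⟩
    have h1 : (((n - 1 : ℕ) : ℕ∞) + 1) ≤ semPlus h I (3 * Nat.card M + p) (w n) :=
      le_sSup ⟨n - 1, rfl, hsub hc.1 (hw n (n - 1) (by omega))⟩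
    have h2 : n - 1 + 1 ≤ B := by exact_mod_cast h1.trans (hB _ hcon)
    omega
  · obtain ⟨B, hB⟩ := (hg.1.trans hg'.2).exists_bound 0
    refine ⟨B, fun n hn => hB _ ?_⟩
    exact sInf_le ⟨0, rfl, hsub hc.2 (hw n 0 (by omega))⟩

theorem witnesses_of_expr (hI : IsLowerSet I) (hJ : IsLowerSet J) (hf : f ∈ costFunction h I)
    (hg : g ∈ costFunction h J) {E : SharpExpr A} (hE : (E.map h).val ∈ I \ J) {Ω : ℕ}
    (hΩ : 0 < Ω) (hdvd : (Nat.card M).factorial ∣ Ω) :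
    WitnessesNonDomination f g fun n => E.unfold (Ω * n) := by
  obtain ⟨p, hp⟩ := exists_hasComp_unfold h E hΩ hdvd
  exact witnesses_of_hasComp hI hJ hf hg hE hp

theorem witnesses_of_one (hI : IsLowerSet I) (hJ : IsLowerSet J) (hf : f ∈ costFunction h I)
    (hg : g ∈ costFunction h J) (h1 : (1 : M) ∈ I \ J) :
    WitnessesNonDomination f g fun _ => [] := by
  refine witnesses_of_hasComp (p := 0) hI hJ hf hg h1 fun n t _ => ?_
  exact hasComp_iff.mpr ⟨1, rfl, .nil _ _ _ rfl⟩

theorem SharpExpr.unfold_ne_nil {n : ℕ} (hn : n ≠ 0) (E : SharpExpr A) : E.unfold n ≠ [] := by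
  induction E with
  | letter a => simp [SharpExpr.unfold]
  | mul E F ihE _ => simp [SharpExpr.unfold, ihE]
  | omegaSharp E ih => simp [SharpExpr.unfold, hn, ih]

/-! ### Values of computations -/

theorem mul_mem_sharpClosure {X : Set M} {a b : M} (ha : a ∈ sharpClosure X)
    (hb : b ∈ sharpClosure X) : a * b ∈ sharpClosure X := by
  obtain ⟨E, rfl⟩ := ha
  obtain ⟨F, rfl⟩ := hb
  exact ⟨.mul E F, rfl⟩

theorem sharp_mem_sharpClosure {X : Set M} {e : M} (he : IsIdempotentElem e)
    (h : e ∈ sharpClosure X) : sharp e ∈ sharpClosure X := by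
  obtain ⟨E, rfl⟩ := h
  refine ⟨.omegaSharp E, ?_⟩
  simp only [SharpExpr.map, SharpExpr.val]
  rw [he.pow_eq (Nat.factorial_ne_zero _)]

theorem mem_sharpClosure {X : Set M} {a : M} (ha : a ∈ X) : a ∈ sharpClosure X :=
  ⟨.letter ⟨a, ha⟩, rfl⟩

theorem exists_expr_of_mem_sharpClosure {a : M} (ha : a ∈ sharpClosure (Set.range h)) :
    ∃ E : SharpExpr A, (E.map h).val = a := by
  obtain ⟨E, rfl⟩ := ha
  induction E with
  | letter a =>
    obtain ⟨_, b, rfl⟩ := a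
    exact ⟨.letter b, rfl⟩
  | mul E F ihE ihF =>
    obtain ⟨E', hE⟩ := ihE
    obtain ⟨F', hF⟩ := ihF
    exact ⟨.mul E' F', by simp only [SharpExpr.map, SharpExpr.val, hE, hF]⟩
  | omegaSharp E ih =>
    obtain ⟨E', hE⟩ := ih
    exact ⟨.omegaSharp E', by simp only [SharpExpr.map, SharpExpr.val, hE]⟩

/-- The unit need not belong to the closure. Over empty factors all values are `1`, by `1♯ = 1`, and
such factors drop out of products, so non-empty factors never need it. -/
theorem Seg.mem_sharpClosure {n p x y N : ℕ} {v : M} {w : ℕ → M} {X : Set M}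
    (hw : ∀ i < N, w i ∈ X) (hs : Seg Eq n w p x y v) (hy : y ≤ N) :
    (x = y ∧ v = 1) ∨ (x < y ∧ v ∈ sharpClosure X) := by
  have node : ∀ (p k : ℕ) (C : ℕ → ℕ) (e : M), 1 ≤ k → C k ≤ N →
      (∀ i < k, Seg Eq n w p (C i) (C (i + 1)) e) →
      (∀ i < k, C (i + 1) ≤ N → (C i = C (i + 1) ∧ e = 1) ∨
        (C i < C (i + 1) ∧ e ∈ sharpClosure X)) →
      (C 0 = C k ∧ e = 1) ∨ (C 0 < C k ∧ e ∈ sharpClosure X) := by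
    intro p k C e hk hN hC ih
    have hCle : ∀ i < k, C i ≤ C (i + 1) := fun i hi => (hC i hi).le
    have h0 := le_of_steps hCle (Nat.zero_le k) le_rfl
    by_cases hlt : ∃ i < k, C i < C (i + 1)
    · obtain ⟨i, hi, hlt⟩ := hlt
      have h1 := le_of_steps hCle (Nat.zero_le i) hi.le
      have h2 := le_of_steps hCle (show i + 1 ≤ k from hi) le_rfl
      rcases ih i hi (h2.trans hN) with h | h
      · omega
      · exact .inr ⟨by omega, h.2⟩
    · push Not at hlt
      have h1 : ∀ j ≤ k, C j = C 0 := by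
        intro j hj
        induction j with
        | zero => rfl
        | succ j ihj =>
          have := hlt j (by omega)
          have := hCle j (by omega)
          have := ihj (by omega)
          omega
      have h2 : C 1 ≤ N := (le_of_steps hCle hk le_rfl).trans hN
      rcases ih 0 (by omega) h2 with h | h
      · exact .inl ⟨(h1 k le_rfl).symm, h.2⟩
      · exact absurd (h1 1 hk) h.1.ne'
  induction hs with
  | nil p x v h => exact .inl ⟨rfl, h⟩
  | leaf p x v h => subst h; exact .inr ⟨by omega, StabilisationMonoid.mem_sharpClosure (hw x hy)⟩
  | binary p x y z a b v h1 h2 h ih1 ih2 =>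
    subst h
    rcases ih1 (h2.le.trans hy) with ⟨rfl, rfl⟩ | ⟨hxy, ha⟩
    · simpa using ih2 hy
    · right
      refine ⟨hxy.trans_le h2.le, ?_⟩
      rcases ih2 hy with ⟨_, rfl⟩ | ⟨_, hb⟩
      · simpa using ha
      · exact mul_mem_sharpClosure ha hb
  | idem p k C e v h1 h2 he hc hv ih =>
    subst hv
    exact node p k C v (by omega) hy hc ih
  | stab p k C e v h1 he hc hv ih =>
    subst hv
    rcases node p k C e (by omega) hy hc ih with ⟨h2, rfl⟩ | ⟨h2, h3⟩
    · exact .inl ⟨h2, sharp_one⟩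
    · exact .inr ⟨h2, sharp_mem_sharpClosure he h3⟩

theorem semPlus_le_of_inter_subset {p : ℕ} {u : List A}
    (hIJ : ∀ v ∈ I, (u ≠ [] ∧ v ∈ sharpClosure (Set.range h)) ∨ (u = [] ∧ v = 1) → v ∈ J) :
    semPlus h I p u ≤ semPlus h J p u := by
  refine sSup_le_sSup ?_
  rintro _ ⟨n, rfl, hn⟩
  refine ⟨n, rfl, ?_⟩
  rw [hasComp_iff] at hn ⊢
  obtain ⟨v, hv, hs⟩ := hn
  refine ⟨v, hIJ v hv ?_, hs⟩
  have hw : ∀ i < (u.map h).length, extend (u.map h) i ∈ Set.range h := by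
    intro i hi
    simp only [extend, List.getD_eq_getElem _ _ hi, List.getElem_map]
    exact ⟨_, rfl⟩
  rcases hs.mem_sharpClosure hw le_rfl with ⟨h1, h2⟩ | ⟨h1, h2⟩
  · exact .inr ⟨by simpa using h1.symm, h2⟩
  · exact .inl ⟨by rintro rfl; simp at h1, h2⟩

/-! ### The criterion for domination -/

theorem dominated_of_forall_expr (hf : f ∈ costFunction h I) (hg : g ∈ costFunction h J)
    (hIJ : (sharpClosure (Set.range h) ∪ {1}) ∩ I ⊆ J) : Dominated f g := by
  simp only [costFunction, Set.mem_ofPred_eq, costEquiv_iff] at hf hg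
  refine (hf.1.trans (dominated_of_le fun u => ?_)).trans hg.2
  refine semPlus_le_of_inter_subset fun v hv hv' => hIJ ⟨?_, hv⟩
  rcases hv' with h1 | h1
  · exact .inl h1.2
  · exact .inr h1.2

theorem not_dominated_iff_witness (hI : IsLowerSet I) (hJ : IsLowerSet J)
    (hf : f ∈ costFunction h I) (hg : g ∈ costFunction h J) :
    (¬ Dominated f g ↔ (∃ E : SharpExpr A, (E.map h).val ∈ I \ J) ∨
      WitnessesNonDomination f g fun _ => []) := by
  constructor
  · intro hd
    obtain ⟨a, ⟨ha | ha, haI⟩, haJ⟩ :=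
      Set.not_subset.mp fun hs => hd (dominated_of_forall_expr hf hg hs)
    · obtain ⟨E, rfl⟩ := exists_expr_of_mem_sharpClosure ha
      exact .inl ⟨E, haI, haJ⟩
    · obtain rfl : a = 1 := ha
      exact .inr (witnesses_of_one hI hJ hf hg ⟨haI, haJ⟩)
  · rintro (⟨E, hE⟩ | hw)
    · have hw := witnesses_of_expr hI hJ hf hg hE (Nat.factorial_pos _) dvd_rfl
      exact not_dominated_of_witness hw.1 hw.2
    · exact not_dominated_of_witness hw.1 hw.2

theorem dominated_iff_inter_subset (hI : IsLowerSet I) (hJ : IsLowerSet J)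
    (hf : f ∈ costFunction h I) (hg : g ∈ costFunction h J) :
    Dominated f g ↔ (sharpClosure (Set.range h) ∪ {1}) ∩ I ⊆ J := by
  refine ⟨fun hd a ⟨ha, haI⟩ => ?_, dominated_of_forall_expr hf hg⟩
  by_contra haJ
  refine (not_dominated_iff_witness hI hJ hf hg).mpr ?_ hd
  rcases ha with ha | ha
  · obtain ⟨E, rfl⟩ := exists_expr_of_mem_sharpClosure ha
    exact .inl ⟨E, haI, haJ⟩
  · obtain rfl : a = 1 := ha
    exact .inr (witnesses_of_one hI hJ hf hg ⟨haI, haJ⟩)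

theorem dominated_nonempty_iff (hI : IsLowerSet I) (hJ : IsLowerSet J)
    (hf : f ∈ costFunction h I) (hg : g ∈ costFunction h J) :
    Dominated (fun u : {u : List A // u ≠ []} => f u) (fun u => g u) ↔
      sharpClosure (Set.range h) ∩ I ⊆ J := by
  constructor
  · rintro hd a ⟨ha, haI⟩
    by_contra haJ
    obtain ⟨E, rfl⟩ := exists_expr_of_mem_sharpClosure ha
    have hpos : 0 < (Nat.card M).factorial := Nat.factorial_pos _
    obtain ⟨hw1, B, hB⟩ := witnesses_of_expr hI hJ hf hg ⟨haI, haJ⟩ hpos dvd_rfl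
    -- The index is shifted by one because a `0`-unfolding can be empty.
    refine not_dominated_of_witness (X := {u : List A // u ≠ []})
      (w := fun n => ⟨E.unfold ((Nat.card M).factorial * (n + 1)),
        E.unfold_ne_nil (by positivity)⟩) (fun N => ?_) ⟨B, fun n _ => hB (n + 1) (by omega)⟩ hd
    obtain ⟨n₀, hn₀⟩ := hw1 N
    exact ⟨n₀, fun n hn => hn₀ (n + 1) (by omega)⟩
  · intro hIJ
    simp only [costFunction, Set.mem_ofPred_eq, costEquiv_iff] at hf hg
    refine ((hf.1.comp Subtype.val).trans (dominated_of_le fun u => ?_)).trans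
      (hg.2.comp Subtype.val)
    refine semPlus_le_of_inter_subset fun v hv hv' => hIJ ⟨?_, hv⟩
    rcases hv' with h1 | h1
    · exact h1.2
    · exact absurd h1.1 u.2

end Criterion

end StabilisationMonoid

namespace StabilisationMonoid

/-! ### Products and morphisms -/

section Products

instance instProd {M M' : Type*} [StabilisationMonoid M] [StabilisationMonoid M'] :
    StabilisationMonoid (M × M') where
  __ := (inferInstance : Monoid (M × M'))
  __ := (inferInstance : PartialOrder (M × M'))
  finite := by
    have : Finite M := StabilisationMonoid.finite
    have : Finite M' := StabilisationMonoid.finite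
    infer_instance
  mul_le_mul := fun _ _ _ _ h h' => ⟨mul_le_mul' h.1 h'.1, mul_le_mul' h.2 h'.2⟩
  sharp := fun a => (sharp a.1, sharp a.2)
  sharp_idempotent := fun e he => Prod.ext
    (sharp_idempotent e.1 (congrArg Prod.fst he)) (sharp_idempotent e.2 (congrArg Prod.snd he))
  sharp_mono := fun e f he hf h =>
    ⟨sharp_mono e.1 f.1 (congrArg Prod.fst he) (congrArg Prod.fst hf) h.1,
      sharp_mono e.2 f.2 (congrArg Prod.snd he) (congrArg Prod.snd hf) h.2⟩
  sharp_consistent := fun a b hab hba => Prod.ext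
    (sharp_consistent a.1 b.1 (congrArg Prod.fst hab) (congrArg Prod.fst hba))
    (sharp_consistent a.2 b.2 (congrArg Prod.snd hab) (congrArg Prod.snd hba))
  sharp_le := fun e he =>
    ⟨sharp_le e.1 (congrArg Prod.fst he), sharp_le e.2 (congrArg Prod.snd he)⟩
  sharp_sharp := fun e he => Prod.ext
    (sharp_sharp e.1 (congrArg Prod.fst he)) (sharp_sharp e.2 (congrArg Prod.snd he))
  sharp_one := Prod.ext sharp_one sharp_one

variable {A M N : Type*} [StabilisationMonoid M] [StabilisationMonoid N] {φ : N →* M}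

theorem Seg.map (hφ : ∀ e, φ (sharp e) = sharp (φ e)) {w : ℕ → N} {n p x y : ℕ} {v : N}
    (hs : Seg Eq n w p x y v) : Seg Eq n (fun i => φ (w i)) p x y (φ v) := by
  induction hs with
  | nil p x v h => exact .nil _ _ _ (by rw [h, map_one])
  | leaf p x v h => exact .leaf _ _ _ (by rw [h])
  | binary p x y z a b v _ _ h ih1 ih2 => exact .binary _ _ _ _ _ _ _ ih1 ih2 (by rw [h, map_mul])
  | idem p k C e v h1 h2 he _ hv ih => exact .idem _ _ _ _ _ h1 h2 (he.map φ) ih (by rw [hv])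
  | stab p k C e v h1 he _ hv ih => exact .stab _ _ _ _ _ h1 (he.map φ) ih (by rw [hv, hφ])

theorem HasComp.map (hφ : ∀ e, φ (StabilisationMonoid.sharp e) = StabilisationMonoid.sharp (φ e))
    {n p : ℕ} {u : List A} {h : A → N} {X : Set M}
    (hc : HasComp Eq n p (u.map h) (φ ⁻¹' X)) : HasComp Eq n p (u.map fun a => φ (h a)) X := by
  rw [hasComp_iff] at hc ⊢
  obtain ⟨v, hv, hs⟩ := hc
  refine ⟨φ v, hv, ?_⟩
  have hw : extend (u.map fun a => φ (h a)) = fun i => φ (extend (u.map h) i) := by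
    funext i
    simp only [extend, List.getD_eq_getElem?_getD, List.getElem?_map]
    cases u[i]? <;> simp
  rw [hw]
  simpa using hs.map hφ

/-- Morphisms carry computations forward only, which gives one inequality for `+` and the opposite
one for `-`. Both suffice, since `+` and `-` define the same cost function on each side. The
comparison of cardinals makes `3|N|` admissible for both monoids. -/
theorem costFunction_comap (hφ : ∀ e, φ (sharp e) = sharp (φ e)) (hmono : Monotone φ)
    (hcard : Nat.card M ≤ Nat.card N) {h : A → N} {I : Set M} (hI : IsLowerSet I)
    {f : List A → ℕ∞} (hf : f ∈ costFunction (fun a => φ (h a)) I) :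
    f ∈ costFunction h (φ ⁻¹' I) := by
  set p := 3 * Nat.card N with hp
  have hI' : IsLowerSet (φ ⁻¹' I) := hI.preimage hmono
  have h1 := (sem_mem_costFunction (fun a => φ (h a)) hI (p := p) (by omega)).2
  have h2 := (sem_mem_costFunction h hI' (p := p) le_rfl).2
  simp only [costFunction, Set.mem_ofPred_eq, costEquiv_iff] at hf h1 h2 ⊢
  have h3 : Dominated (semPlus h (φ ⁻¹' I) p) (semPlus (fun a => φ (h a)) I p) := by
    refine dominated_of_le fun u => sSup_le_sSup ?_
    rintro _ ⟨n, rfl, hn⟩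
    exact ⟨n, rfl, hn.map hφ⟩
  have h4 : Dominated (semMinus (fun a => φ (h a)) I p) (semMinus h (φ ⁻¹' I) p) := by
    refine dominated_of_le fun u => sInf_le_sInf ?_
    rintro _ ⟨n, rfl, hn⟩
    exact ⟨n, rfl, HasComp.map (X := Iᶜ) hφ hn⟩
  exact ⟨(hf.1.trans h1.1.2).trans (h4.trans h2.1.1), (h3.trans h1.2.1.1).trans hf.2⟩

/-- The projections turn the two recognisers into one product monoid with two ideals, to which the
criterion for a common morphism applies. -/
theorem dominated_iff_prod {M M' : Type*} [StabilisationMonoid M] [StabilisationMonoid M']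
    {h : A → M} {h' : A → M'} {I : Set M} {J : Set M'} (hI : IsLowerSet I) (hJ : IsLowerSet J)
    {f g : List A → ℕ∞} (hf : f ∈ costFunction h I) (hg : g ∈ costFunction h' J) :
    Dominated f g ↔ ∀ a : M × M', a ∈ sharpClosure (Set.range fun a => (h a, h' a)) ∪ {1} →
      a.1 ∈ I → a.2 ∈ J := by
  have : Finite M := StabilisationMonoid.finite
  have : Finite M' := StabilisationMonoid.finite
  have hf' : f ∈ costFunction (fun a => (h a, h' a)) (MonoidHom.fst M M' ⁻¹' I) :=
    costFunction_comap (φ := MonoidHom.fst M M') (fun _ => rfl) monotone_fst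
      (by rw [Nat.card_prod]; exact Nat.le_mul_of_pos_right _ Nat.card_pos) hI hf
  have hg' : g ∈ costFunction (fun a => (h a, h' a)) (MonoidHom.snd M M' ⁻¹' J) :=
    costFunction_comap (φ := MonoidHom.snd M M') (fun _ => rfl) monotone_snd
      (by rw [Nat.card_prod]; exact Nat.le_mul_of_pos_left _ Nat.card_pos) hJ hg
  rw [dominated_iff_inter_subset (hI.preimage monotone_fst) (hJ.preimage monotone_snd) hf' hg']
  exact ⟨fun hs a h1 h2 => hs ⟨h1, h2⟩, fun hs a ⟨h1, h2⟩ => hs a h1 h2⟩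

end Products

/-! ### Saturation -/

section Saturation

/-- One round of closing a list under a product and under a map on its idempotents. -/
def saturateStep {X : Type*} [DecidableEq X] (m : X → X → X) (s : X → X) (L : List X) : List X :=
  L ++ L.flatMap (fun a => L.map (m a)) ++ L.flatMap fun a => if m a a = a then [s a] else []

theorem mem_saturateStep {X : Type*} [DecidableEq X] {m : X → X → X} {s : X → X} {L : List X}
    {x : X} : x ∈ saturateStep m s L ↔
      x ∈ L ∨ (∃ a ∈ L, ∃ b ∈ L, m a b = x) ∨ ∃ a ∈ L, m a a = a ∧ s a = x := by
  have h : ∀ a : X, x ∈ (if m a a = a then [s a] else []) ↔ m a a = a ∧ s a = x := by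
    intro a
    split_ifs with h <;> simp [h, eq_comm]
  simp only [saturateStep, List.mem_append, List.mem_flatMap, List.mem_map, h, or_assoc]

/-- Saturation on names simulates saturation in the monoid. Injectivity is needed for the tests of
idempotency to agree. -/
theorem map_saturateStep {X Y : Type*} [DecidableEq X] [DecidableEq Y] {κ : X → Y}
    (hκ : Function.Injective κ) {m : X → X → X} {s : X → X} {m' : Y → Y → Y} {s' : Y → Y}
    (hm : ∀ a b, m' (κ a) (κ b) = κ (m a b)) (hs : ∀ a, s' (κ a) = κ (s a)) (L : List X) :
    saturateStep m' s' (L.map κ) = (saturateStep m s L).map κ := by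
  simp only [saturateStep, List.map_append, List.map_flatMap, List.flatMap_map, List.map_map, hm,
    hs, hκ.eq_iff]
  congr 1
  · congr 2
    funext a
    exact List.map_congr_left fun b _ => hm a b
  · congr 1
    funext a
    split_ifs <;> simp

theorem iterate_map_saturateStep {X Y : Type*} [DecidableEq X] [DecidableEq Y] {κ : X → Y}
    (hκ : Function.Injective κ) {m : X → X → X} {s : X → X} {m' : Y → Y → Y} {s' : Y → Y}
    (hm : ∀ a b, m' (κ a) (κ b) = κ (m a b)) (hs : ∀ a, s' (κ a) = κ (s a)) (L : List X) (n : ℕ) :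
    (saturateStep m' s')^[n] (L.map κ) = ((saturateStep m s)^[n] L).map κ := by
  induction n with
  | zero => rfl
  | succ n ih => rw [Function.iterate_succ_apply', ih, map_saturateStep hκ hm hs,
      Function.iterate_succ_apply']

/-- The set of members grows strictly until it is stationary, hence for at most `|X|` rounds. -/
theorem iterate_saturateStep_stable {X : Type*} [DecidableEq X] [Fintype X] (m : X → X → X)
    (s : X → X) (L : List X) {n : ℕ} (hn : Fintype.card X ≤ n) (x : X)
    (hx : x ∈ saturateStep m s ((saturateStep m s)^[n] L)) : x ∈ (saturateStep m s)^[n] L := by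
  set F : ℕ → Finset X := fun n => ((saturateStep m s)^[n] L).toFinset with hF
  have hsucc : ∀ n, (saturateStep m s)^[n + 1] L = saturateStep m s ((saturateStep m s)^[n] L) :=
    fun n => Function.iterate_succ_apply' _ _ _
  have hsub : ∀ n, F n ⊆ F (n + 1) := by
    intro n x hx
    simp only [hF, List.mem_toFinset] at hx ⊢
    rw [hsucc, mem_saturateStep]
    exact .inl hx
  have hmono : Monotone fun n => (F n).card :=
    monotone_nat_of_le_succ fun n => Finset.card_le_card (hsub n)
  have heq : ∀ n, (F n).card = (F (n + 1)).card → F n = F (n + 1) :=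
    fun n h => Finset.eq_of_subset_of_card_le (hsub n) h.ge
  have hstab : ∀ n, (F n).card = (F (n + 1)).card → (F (n + 1)).card = (F (n + 2)).card := by
    intro n h
    have h1 : ∀ x, x ∈ (saturateStep m s)^[n] L ↔ x ∈ (saturateStep m s)^[n + 1] L := by
      intro x
      have := Finset.ext_iff.mp (heq n h) x
      simpa only [hF, List.mem_toFinset] using this
    congr 1
    ext x
    simp only [hF, List.mem_toFinset]
    rw [hsucc n, hsucc (n + 1), mem_saturateStep, mem_saturateStep]
    simp only [h1]
  have h1 := Nat.stabilises_of_monotone hmono (fun n => Finset.card_le_univ (F n)) hstab hn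
  have h2 := Nat.stabilises_of_monotone hmono (fun n => Finset.card_le_univ (F n)) hstab
    (hn.trans (Nat.le_succ n))
  have h3 := Finset.ext_iff.mp (heq n (h1.trans h2.symm)) x
  simp only [hF, List.mem_toFinset] at h3
  rw [h3, hsucc]
  exact hx

/-- Saturation computes the closure of a set of generators. -/
theorem mem_iterate_saturateStep_iff {N : Type*} [StabilisationMonoid N] [DecidableEq N]
    {X : Set N} {L : List N} (hL : ∀ x, x ∈ L ↔ x ∈ X ∪ {1}) {n : ℕ} (hn : Nat.card N ≤ n)
    (x : N) : x ∈ (saturateStep (· * ·) sharp)^[n] L ↔ x ∈ sharpClosure X ∪ {1} := by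
  have hfin : Finite N := StabilisationMonoid.finite
  have : Fintype N := Fintype.ofFinite N
  rw [Nat.card_eq_fintype_card] at hn
  constructor
  · clear hn
    induction n generalizing x with
    | zero =>
      intro hx
      rcases (hL x).mp hx with h | h
      · exact .inl (mem_sharpClosure h)
      · exact .inr h
    | succ n ih =>
      rw [Function.iterate_succ_apply', mem_saturateStep]
      rintro (h | ⟨a, ha, b, hb, rfl⟩ | ⟨a, ha, hi, rfl⟩)
      · exact ih x h
      · rcases ih a ha with ha | ha
        · rcases ih b hb with hb | hb
          · exact .inl (mul_mem_sharpClosure ha hb)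
          · obtain rfl : b = 1 := hb
            exact .inl (by simpa using ha)
        · obtain rfl : a = 1 := ha
          simpa using ih b hb
      · rcases ih a ha with ha | ha
        · exact .inl (sharp_mem_sharpClosure hi ha)
        · obtain rfl : a = 1 := ha
          exact .inr sharp_one
  · have hL0 : ∀ y ∈ L, y ∈ (saturateStep (· * ·) sharp)^[n] L := by
      intro y hy
      clear hn
      induction n with
      | zero => exact hy
      | succ n ih =>
        rw [Function.iterate_succ_apply', mem_saturateStep]
        exact .inl ih
    have hcl := iterate_saturateStep_stable (· * ·) (sharp : N → N) L hn
    simp only [mem_saturateStep] at hcl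
    have hmul : ∀ a b, a ∈ (saturateStep (· * ·) sharp)^[n] L →
        b ∈ (saturateStep (· * ·) sharp)^[n] L → a * b ∈ (saturateStep (· * ·) sharp)^[n] L :=
      fun a b ha hb => hcl _ (.inr (.inl ⟨a, ha, b, hb, rfl⟩))
    have h1 : (1 : N) ∈ (saturateStep (· * ·) sharp)^[n] L := hL0 1 ((hL 1).mpr (.inr rfl))
    rintro (⟨E, rfl⟩ | hx)
    · induction E with
      | letter a => exact hL0 _ ((hL _).mpr (.inl a.2))
      | mul E F ihE ihF => exact hmul _ _ ihE ihF
      | omegaSharp E ih =>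
        -- The `ω`-power needs no operation of its own: it is reached by products, and the closure
        -- under `♯` of idempotents does the rest.
        have hpow : ∀ k, (E.map Subtype.val).val ^ k ∈ (saturateStep (· * ·) sharp)^[n] L := by
          intro k
          induction k with
          | zero => simpa using h1
          | succ k ihk =>
            rw [pow_succ]
            exact hmul _ _ ihk ih
        exact hcl _ (.inr (.inr ⟨_, hpow _, isIdempotentElem_pow_factorial _, rfl⟩))
    · obtain rfl : x = 1 := hx
      exact h1

end Saturation

/-! ### The decision procedure -/

section Decision

/-- The product of pairs of element names, read in the tables of two codes. -/
def codeMul (q : RecogniserCode × RecogniserCode) (a b : ℕ × ℕ) : ℕ × ℕ :=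
  ((q.1.1.getD a.1 []).getD b.1 0, (q.2.1.getD a.2 []).getD b.2 0)

/-- The stabilisation of pairs of element names. -/
def codeSharp (q : RecogniserCode × RecogniserCode) (a : ℕ × ℕ) : ℕ × ℕ :=
  (q.1.2.2.2.1.getD a.1 0, q.2.2.2.2.1.getD a.2 0)

/-- The names of the unit and of the images of the letters in the product monoid. -/
def codeGenerators (q : RecogniserCode × RecogniserCode) : List (ℕ × ℕ) :=
  (q.1.2.2.1, q.2.2.2.1) :: (List.range q.1.2.2.2.2.1.length).map fun i =>
    (q.1.2.2.2.2.1.getD i 0, q.2.2.2.2.2.1.getD i 0)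

/-- The decision procedure for domination: saturate the generators of the product monoid, and look
for an element in the first ideal and not in the second one. -/
def CodeDominated (q : RecogniserCode × RecogniserCode) : Prop :=
  ∀ a ∈ (saturateStep (codeMul q) (codeSharp q))^[q.1.1.length * q.2.1.length] (codeGenerators q),
    q.1.2.2.2.2.2.getD a.1 false = false ∨ q.2.2.2.2.2.2.getD a.2 false = true

open Primrec in
theorem primrec_codeMul {X : Type*} [Primcodable X] {q : X → RecogniserCode × RecogniserCode}
    {a b : X → ℕ × ℕ} (hq : Primrec q) (ha : Primrec a) (hb : Primrec b) :
    Primrec fun x => codeMul (q x) (a x) (b x) :=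
  pair
    ((list_getD 0).comp ((list_getD []).comp (fst.comp (fst.comp hq)) (fst.comp ha)) (fst.comp hb))
    ((list_getD 0).comp ((list_getD []).comp (fst.comp (snd.comp hq)) (snd.comp ha)) (snd.comp hb))

open Primrec in
theorem primrec_codeSharp {X : Type*} [Primcodable X] {q : X → RecogniserCode × RecogniserCode}
    {a : X → ℕ × ℕ} (hq : Primrec q) (ha : Primrec a) :
    Primrec fun x => codeSharp (q x) (a x) := by
  have sharps : Primrec fun c : RecogniserCode => c.2.2.2.1 := fst.comp (snd.comp (snd.comp snd))
  exact pair ((list_getD 0).comp (sharps.comp (fst.comp hq)) (fst.comp ha))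
    ((list_getD 0).comp (sharps.comp (snd.comp hq)) (snd.comp ha))

open Primrec in
theorem primrec_codeGenerators : Primrec codeGenerators := by
  have unit : Primrec fun c : RecogniserCode => c.2.2.1 := fst.comp (snd.comp snd)
  have letters : Primrec fun c : RecogniserCode => c.2.2.2.2.1 :=
    fst.comp (snd.comp (snd.comp (snd.comp snd)))
  refine list_cons.comp (pair (unit.comp fst) (unit.comp snd))
    (list_map (list_range.comp (list_length.comp (letters.comp fst))) ?_)
  exact pair ((list_getD 0).comp (letters.comp (fst.comp fst)) snd)
    ((list_getD 0).comp (letters.comp (snd.comp fst)) snd)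

open Primrec in
theorem primrec_saturateStep : Primrec₂ fun (q : RecogniserCode × RecogniserCode)
    (L : List (ℕ × ℕ)) => saturateStep (codeMul q) (codeSharp q) L := by
  refine list_append.comp (list_append.comp snd (list_flatMap snd (list_map (snd.comp fst) ?_)))
    (list_flatMap snd (Primrec.ite ?_ ?_ (const [])))
  · exact primrec_codeMul (fst.comp (fst.comp fst)) (snd.comp fst) snd
  · exact Primrec.eq.comp (primrec_codeMul (fst.comp fst) snd snd) snd
  · exact list_cons.comp (primrec_codeSharp (fst.comp fst) snd) (const [])

-- The procedure is primitive recursive: an iteration of list operations followed by a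
-- quantification over a list.
open Primrec in
theorem computablePred_codeDominated : ComputablePred CodeDominated := by
  have sat : Primrec fun q : RecogniserCode × RecogniserCode =>
      (saturateStep (codeMul q) (codeSharp q))^[q.1.1.length * q.2.1.length] (codeGenerators q) :=
    nat_iterate (nat_mul.comp (list_length.comp (fst.comp fst)) (list_length.comp (fst.comp snd)))
      primrec_codeGenerators primrec_saturateStep
  have ideal : Primrec fun c : RecogniserCode => c.2.2.2.2.2 :=
    snd.comp (snd.comp (snd.comp (snd.comp snd)))
  have rel : PrimrecRel fun (a : ℕ × ℕ) (q : RecogniserCode × RecogniserCode) =>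
      q.1.2.2.2.2.2.getD a.1 false = false ∨ q.2.2.2.2.2.2.getD a.2 false = true := by
    refine PrimrecPred.or (Primrec.eq.comp ?_ (const false)) (Primrec.eq.comp ?_ (const true))
    · exact (list_getD false).comp (ideal.comp (fst.comp snd)) (fst.comp fst)
    · exact (list_getD false).comp (ideal.comp (snd.comp snd)) (snd.comp fst)
  obtain ⟨hdec, hprim⟩ := rel.forall_mem_list.comp sat Primrec.id
  exact ⟨hdec, hprim.to_comp⟩

theorem getD_ofFn {X : Type*} {k : ℕ} (u : Fin k → X) (d : X) (i : Fin k) :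
    (List.ofFn u).getD i d = u i := by
  rw [List.getD_eq_getElem _ _ (by simp)]
  simp

theorem codeDominated_encode_iff {A M M' : Type*} [StabilisationMonoid M] [StabilisationMonoid M']
    {m k k' : ℕ} (eA : Fin m ≃ A) (eM : Fin k ≃ M) (eM' : Fin k' ≃ M') (h : A → M) (h' : A → M')
    (I : Set M) (J : Set M') :
    CodeDominated (encode eA eM h I, encode eA eM' h' J) ↔
      ∀ a : M × M', a ∈ sharpClosure (Set.range fun a => (h a, h' a)) ∪ {1} →
        a.1 ∈ I → a.2 ∈ J := by
  classical
  set κ : M × M' → ℕ × ℕ := fun a => ((eM.symm a.1 : ℕ), (eM'.symm a.2 : ℕ)) with hκ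
  have hinj : Function.Injective κ := by
    rintro ⟨a, b⟩ ⟨a', b'⟩ hab
    simpa [hκ, Fin.val_inj] using hab
  set q := (encode eA eM h I, encode eA eM' h' J) with hq
  -- Names of elements are always within the tables, so the default values are never read.
  have hmul : ∀ a b, codeMul q (κ a) (κ b) = κ (a * b) := by
    intro a b
    simp [hq, hκ, codeMul, encode]
  have hsharp : ∀ a, codeSharp q (κ a) = κ (sharp a) := by
    intro a
    simp only [hq, hκ, codeSharp, encode, getD_ofFn, Equiv.apply_symm_apply]
    rfl
  set L : List (M × M') := 1 :: List.ofFn fun i => (h (eA i), h' (eA i)) with hL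
  have hgen : codeGenerators q = L.map κ := by
    simp only [hq, codeGenerators, encode, hL, List.map_cons, List.length_ofFn, List.map_ofFn]
    congr 1
    apply List.ext_getElem
    · simp
    · intro i h1 h2
      have hi : i < m := by simpa using h1
      simp [hκ, hi]
  -- The number of rounds is the cardinality of the product monoid, after which saturation is
  -- stationary.
  have hlen : q.1.1.length * q.2.1.length = Nat.card (M × M') := by
    rw [Nat.card_prod, Nat.card_congr eM.symm, Nat.card_congr eM'.symm]
    simp [hq, encode]
  have hLmem : ∀ x, x ∈ L ↔ x ∈ (Set.range fun a => (h a, h' a)) ∪ {1} := by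
    intro x
    simp only [hL, List.mem_cons, List.mem_ofFn, Set.mem_union, Set.mem_range,
      Set.mem_singleton_iff, or_comm (a := x = 1)]
    exact or_congr_left ⟨fun ⟨i, hi⟩ => ⟨eA i, hi⟩, fun ⟨a, ha⟩ => ⟨eA.symm a, by simpa using ha⟩⟩
  rw [CodeDominated, hgen, iterate_map_saturateStep hinj hmul hsharp, hlen]
  simp only [List.forall_mem_map]
  refine forall_congr' fun a => ?_
  rw [mem_iterate_saturateStep_iff hLmem le_rfl]
  refine imp_congr_right fun _ => ?_
  simp only [hq, hκ, encode, getD_ofFn, Equiv.apply_symm_apply, decide_eq_false_iff_not,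
    decide_eq_true_eq]
  exact imp_iff_not_or.symm

end Decision

end StabilisationMonoid

/-! ### The main theorem. -/

open StabilisationMonoid in
theorem mainTheorem4 :
    -- decidability: one algorithm, given two presented recognisers over the same alphabet,
    -- decides whether the first recognised cost function is dominated by the second
    (∃ D : RecogniserCode × RecogniserCode → Prop, ComputablePred D ∧
      ∀ (A M M' : Type*) [StabilisationMonoid M] [StabilisationMonoid M'] (m k k' : ℕ)
        (eA : Fin m ≃ A) (eM : Fin k ≃ M) (eM' : Fin k' ≃ M')
        (h : A → M) (h' : A → M') (I : Set M) (J : Set M'),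
        IsLowerSet I → IsLowerSet J →
        ∀ f ∈ costFunction h I, ∀ g ∈ costFunction h' J,
          (D (encode eA eM h I, encode eA eM' h' J) ↔ Dominated f g)) ∧
    -- the cost function recognised by `M, h, I` is well defined
    (∀ (A M : Type*) [StabilisationMonoid M] (h : A → M) (I : Set M), IsLowerSet I →
      ∀ p ≥ 3 * Nat.card M,
        semMinusMinus h I p ∈ costFunction h I ∧ semMinus h I p ∈ costFunction h I ∧
        semPlus h I p ∈ costFunction h I ∧ semPlusPlus h I p ∈ costFunction h I) ∧
    -- the criterion, and the witnesses
    (∀ (A M : Type*) [StabilisationMonoid M] (h : A → M) (I J : Set M),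
      IsLowerSet I → IsLowerSet J →
      ∀ f ∈ costFunction h I, ∀ g ∈ costFunction h J,
        -- over all words: the unit is the value of the empty word
        (Dominated f g ↔ (sharpClosure (Set.range h) ∪ {1}) ∩ I ⊆ J) ∧
        -- over the non-empty words
        (Dominated (fun u : {u : List A // u ≠ []} => f u) (fun u => g u) ↔
          sharpClosure (Set.range h) ∩ I ⊆ J) ∧
        -- every `♯`-expression of value in `I \ J` is a witness of non-domination
        (∀ E : SharpExpr A, (E.map h).val ∈ I \ J →
          ∀ Ω : ℕ, 0 < Ω → (Nat.card M).factorial ∣ Ω →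
            WitnessesNonDomination f g (fun n => E.unfold (Ω * n))) ∧
        -- and non-domination is always witnessed so, or by the empty word
        (¬ Dominated f g ↔
          (∃ E : SharpExpr A, (E.map h).val ∈ I \ J) ∨
            WitnessesNonDomination f g (fun _ => []))) := by
  refine ⟨⟨CodeDominated, computablePred_codeDominated, ?_⟩, ?_, ?_⟩
  · intro A M M' _ _ m k k' eA eM eM' h h' I J hI hJ f hf g hg
    rw [codeDominated_encode_iff, dominated_iff_prod hI hJ hf hg]
  · intro A M _ h I hI p hp
    exact sem_mem_costFunction h hI hp
  · intro A M _ h I J hI hJ f hf g hg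
    exact ⟨dominated_iff_inter_subset hI hJ hf hg, dominated_nonempty_iff hI hJ hf hg,
      fun E hE Ω hΩ hdvd => witnesses_of_expr hI hJ hf hg hE hΩ hdvd,
      not_dominated_iff_witness hI hJ hf hg⟩
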